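/- Let $d\ge 1$ be an integer and $\beta>0$ be such that $2\beta+d-2>0$ and, if $d\ge 3$, also $\beta\ge 1$. Let $\mathcal H^\beta_K([0,1]^d)$ be the set of continuous $f:[0,1]^d\to\mathbb R$ whose partial derivatives up to order $s$ exist and are continuous in $(0,1)^d$ and whose $\beta$-Hölder norm $$\max_{|k|\le s}\sup_{x}|D^kf(x)|+\max_{|k|=s}\sup_{x\ne y}\frac{|D^kf(x)-D^kf(y)|}{|x-y|^{\beta-s}}$$ is at most $K$; here $s$ is the largest integer strictly smaller than $\beta$ and the suprema are over $(0,1)^d$. For $D\ge d$ let $\mathcal G_0$ be the set of maps $g=(g_1,\dots,g_D):[0,1]^d\to\mathbb R^D$ with all $g_i\in\mathcal H^\beta_K([0,1]^d)$. For $g\in\mathcal G_0$ let $Q_g$ be the law of $g(Z)$ with $Z$ uniform on $[0,1]^d$, and for $\sigma_0\ge 0$ let $P_{g,\sigma_0}=Q_g*\mathcal N(0,\sigma_0^2 I_D)$. Define the minimax risk $$\mathfrak M_n(\mathcal G_0,\sigma_0)=\inf_{\hat Q}\ \sup_{g\in\mathcal G_0}\ \mathbb E\,W_1(\hat Q,Q_g),$$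 where $W_1$ is the $L^1$-Wasserstein distance for the Euclidean distance on $\mathbb R^D$, the infimum is over all (measurable) estimators $\hat Q=\hat Q(X_1,\dots,X_n)$ with values in the probability measures on $\mathbb R^D$, and $X_1,\dots,X_n$ are i.i.d. with law $P_{g,\sigma_0}$. Then there are constants $K_0$ and $C>0$, depending only on $\beta$ and $d$, such that for all $K\ge K_0$, all $D\ge d$, all $\sigma_0\ge 0$ and all $n\ge 1$, $$\mathfrak M_n(\mathcal G_0,\sigma_0)\ \ge\ C\,n^{-\frac{\beta}{2\beta+d-2}}.$$ -/

import Mathlib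

open MeasureTheory ProbabilityTheory
open scoped ENNReal

noncomputable section

/-- The closed unit cube `[0,1]^d` in `ℝ^d`. -/
def unitCube (d : ℕ) : Set (EuclideanSpace ℝ (Fin d)) :=
  {z | ∀ i, 0 ≤ z i ∧ z i ≤ 1}

/-- The uniform distribution on `[0,1]^d`: Lebesgue measure restricted to the cube. -/
def uniformCube (d : ℕ) : Measure (EuclideanSpace ℝ (Fin d)) :=
  volume.restrict (unitCube d)

/-- The largest integer strictly smaller than `β` (for `β > 0`). -/
def holderOrder (β : ℝ) : ℕ := ⌈β⌉₊ - 1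

/-- The mixed partial derivative `∂_{i_1} ⋯ ∂_{i_j} f (x)` of order `j`. When `i` runs over all
`j`-tuples, this runs over all partial derivatives `D^k f` with `|k| = j` of a `C^j` function. -/
def partialDeriv {d j : ℕ} (i : Fin j → Fin d) (f : EuclideanSpace ℝ (Fin d) → ℝ)
    (x : EuclideanSpace ℝ (Fin d)) : ℝ :=
  iteratedFDeriv ℝ j f x (fun l => EuclideanSpace.single (i l) (1 : ℝ))

/-- The `β`-Hölder norm on `A`, with values in `[0, ∞]`: the maximum over all multi-indices
`|k| ≤ s` of `sup |D^k f|`, plus the maximum over all `|k| = s` of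
`sup_{x ≠ y} |D^k f(x) - D^k f(y)| / |x - y|^(β - s)`, where `s` is the largest integer strictly
smaller than `β` and the suprema are over the interior of `A`. -/
def holderNorm {d : ℕ} (β : ℝ) (A : Set (EuclideanSpace ℝ (Fin d)))
    (f : EuclideanSpace ℝ (Fin d) → ℝ) : ℝ≥0∞ :=
  (⨆ (j : ℕ) (_ : j ≤ holderOrder β) (i : Fin j → Fin d) (x ∈ interior A),
      ENNReal.ofReal |partialDeriv i f x|) +
  (⨆ (i : Fin (holderOrder β) → Fin d) (x ∈ interior A) (y ∈ interior A) (_ : x ≠ y),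
      ENNReal.ofReal
        (|partialDeriv i f x - partialDeriv i f y| / ‖x - y‖ ^ (β - (holderOrder β : ℝ))))

/-- The `β`-Hölder ball `H^β_K(A)`: functions which are continuous on `A`, have continuous partial
derivatives in the interior of `A` up to the order that enters the norm, and have `β`-Hölder norm
at most `K`. Only the values on `A` matter. -/
def holderBall {d : ℕ} (β K : ℝ) (A : Set (EuclideanSpace ℝ (Fin d))) :
    Set (EuclideanSpace ℝ (Fin d) → ℝ) :=
  {f | ContinuousOn f A ∧ ContDiffOn ℝ (holderOrder β : ℕ) f (interior A) ∧
    holderNorm β A f ≤ ENNReal.ofReal K}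

/-- The class of generators `H^β_K([0,1]^d) × ⋯ × H^β_K([0,1]^d)` (`D` factors). -/
def generatorClass (d D : ℕ) (β K : ℝ) :
    Set (EuclideanSpace ℝ (Fin d) → EuclideanSpace ℝ (Fin D)) :=
  {g | ∀ i : Fin D, (fun z => g z i) ∈ holderBall β K (unitCube d)}

/-- `Q_g`: the law of `g(Z)`, where `Z` is uniform on `[0,1]^d`. -/
def generatedLaw {d D : ℕ} (g : EuclideanSpace ℝ (Fin d) → EuclideanSpace ℝ (Fin D)) :
    Measure (EuclideanSpace ℝ (Fin D)) :=
  (uniformCube d).map g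

/-- `P_{g,σ} = Q_g * N(0, σ² I)`: the law of one observation. -/
def dataLaw {d D : ℕ} (g : EuclideanSpace ℝ (Fin d) → EuclideanSpace ℝ (Fin D)) (σ : ℝ) :
    Measure (EuclideanSpace ℝ (Fin D)) :=
  (generatedLaw g).conv
    (multivariateGaussian 0 (σ ^ 2 • (1 : Matrix (Fin D) (Fin D) ℝ)))

/-- The `L¹`-Wasserstein distance: the infimum of `∫ |x - y| dπ(x, y)` over all couplings `π` of
`μ` and `ν`. -/
def wasserstein1 {D : ℕ} (μ ν : Measure (EuclideanSpace ℝ (Fin D))) : ℝ≥0∞ :=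
  ⨅ (π : Measure (EuclideanSpace ℝ (Fin D) × EuclideanSpace ℝ (Fin D)))
    (_ : π.map Prod.fst = μ ∧ π.map Prod.snd = ν), ∫⁻ p, edist p.1 p.2 ∂π

/-- Estimators of a distribution on `ℝ^D` from `n` observations: measurable maps from the sample
space to the probability measures on `ℝ^D`. -/
def estimators (n D : ℕ) :
    Set ((Fin n → EuclideanSpace ℝ (Fin D)) → Measure (EuclideanSpace ℝ (Fin D))) :=
  {Qhat | Measurable Qhat ∧ ∀ x, IsProbabilityMeasure (Qhat x)}

/-- The minimax risk over the class `G` at noise level `σ` for the sample size `n`: the infimum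
over all estimators of the supremum over `g ∈ G` of the expected `W₁`-distance between the
estimator and `Q_g`, when the `n` observations are i.i.d. with law `P_{g,σ}`. -/
def wassersteinMinimaxRisk {d D : ℕ} (G : Set (EuclideanSpace ℝ (Fin d) → EuclideanSpace ℝ (Fin D)))
    (σ : ℝ) (n : ℕ) : ℝ≥0∞ :=
  ⨅ Qhat ∈ estimators n D, ⨆ g ∈ G,
    ∫⁻ x, wasserstein1 (Qhat x) (generatedLaw g) ∂(Measure.pi fun _ : Fin n => dataLaw g σ)

end

/-! The bound comes from Assouad's method on a hypercube of small deformations of the cube. Cut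
`[0,1]^d` into `m ^ d` cells of side `h = 1/m`. For `ε`, the generator moves the points of every
cell with `ε j = true` by a bump of height `a h` in one fixed coordinate direction `v`; the result
is padded by zeros to dimension `D`. Membership in the Hölder ball asks for `a h · h^(-β) ≲ 1`, that
is `a ≲ m^(1-β)`.

Indistinguishability is proved on the latent cube, so that neither densities on `ℝ^D` nor the noise
level matter. Switching on bump `j`, with profile `F`, is precomposition with the bijection `z ↦ z +
F z • v` of the cube (`perturb_update`), which carries the density `J = 1 + ∂_v F` to the uniform
law (`map_withDensity_add_smul`). Hence both data laws are images, under one and the same map and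
with the same independent noise, of the density `J` and of the uniform law. Their χ²-divergence is
controlled by `∫ (∂_v F)² ≈ a² h^d`, and if `n a² h^d` is small the two samples share half of their
mass (`exists_common_le_pi_conv`).

Separation: each cell carries a 1-Lipschitz test function with slope 1 in the direction `v` near the
centre, whose integral changes by about `a h · h^d` when the bump is switched on. The supports are
disjoint, so `W₁` dominates half of the sum over all cells (`sum_integral_sub_le_wasserstein1`). By
`assouad` the risk is at least of order `m^d · a h^(d+1) = a / m`.

It remains to maximise `a / m` under `a ≲ 1`, `a ≲ m^(1-β)` and `n a² ≲ m^d`. If `β ≥ 1`, take `m ≈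
n^(1/(2β+d-2))` and `a ≈ m^(1-β)`. If `d ≤ 2`, a single cell with `a ≈ n^(-1/2)` already suffices.
-/

noncomputable section

/-! ### Common mass of product measures from a χ² bound -/

/-- A power of a measure with a bounded density has the product density. -/
theorem pi_withDensity_ofReal {E : Type*} [MeasurableSpace E] {n : ℕ} (μ : Measure E)
    [IsProbabilityMeasure μ] {J : E → ℝ} {B : ℝ} (hJ : Measurable J) (h0 : ∀ x, 0 ≤ J x)
    (hB : ∀ x, J x ≤ B) :
    Measure.pi (fun _ : Fin n => μ.withDensity fun x => ENNReal.ofReal (J x)) =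
      (Measure.pi fun _ : Fin n => μ).withDensity
        fun x => ENNReal.ofReal (∏ i, J (x i)) := by
  have hint : Integrable J μ :=
    Integrable.of_bound hJ.aestronglyMeasurable B
      (.of_forall fun x => by rw [Real.norm_eq_abs, abs_of_nonneg (h0 x)]; exact hB x)
  have : IsFiniteMeasure (μ.withDensity fun x => ENNReal.ofReal (J x)) :=
    isFiniteMeasure_withDensity_ofReal hint.2
  refine (Measure.pi_eq fun s hs => ?_)
  have hs' : MeasurableSet (Set.univ.pi s) := MeasurableSet.univ_pi hs
  have hprod : ∀ x : Fin n → E, (Set.univ.pi s).indicator (fun x => ∏ i, J (x i)) x =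
      ∏ i, (s i).indicator J (x i) := by
    intro x
    by_cases hx : x ∈ Set.univ.pi s
    · rw [Set.indicator_of_mem hx]
      exact Finset.prod_congr rfl fun i _ => (Set.indicator_of_mem (hx i trivial) _).symm
    · rw [Set.indicator_of_notMem hx]
      simp only [Set.mem_pi, Set.mem_univ, true_implies, not_forall] at hx
      obtain ⟨i, hi⟩ := hx
      exact (Finset.prod_eq_zero (Finset.mem_univ i) (Set.indicator_of_notMem hi _)).symm
  have hi0 : ∀ i x, 0 ≤ (s i).indicator J x := fun i x =>
    Set.indicator_nonneg (fun y _ => h0 y) x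
  have hii : ∀ i, Integrable ((s i).indicator J) μ := fun i => hint.indicator (hs i)
  rw [withDensity_apply _ hs', ← lintegral_indicator hs']
  have e1 : ∀ x : Fin n → E, (Set.univ.pi s).indicator
      (fun x => ENNReal.ofReal (∏ i, J (x i))) x =
        ENNReal.ofReal (∏ i, (s i).indicator J (x i)) := by
    intro x
    rw [← hprod]
    by_cases hx : x ∈ Set.univ.pi s <;> simp [hx]
  simp_rw [e1]
  rw [← ofReal_integral_eq_lintegral_ofReal (Integrable.fintype_prod hii)
    (.of_forall fun x => Finset.prod_nonneg fun i _ => hi0 i _),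
    integral_fintype_prod_eq_prod, ENNReal.ofReal_prod_of_nonneg
      (fun i _ => integral_nonneg (hi0 i))]
  refine Finset.prod_congr rfl fun i _ => ?_
  rw [withDensity_apply _ (hs i), ← lintegral_indicator (hs i),
    ofReal_integral_eq_lintegral_ofReal (hii i) (.of_forall (hi0 i))]
  refine lintegral_congr fun x => ?_
  by_cases hx : x ∈ s i <;> simp [hx]

theorem integral_sub_one_sq {E : Type*} [MeasurableSpace E] {μ : Measure E}
    [IsProbabilityMeasure μ] {J : E → ℝ} (h1 : Integrable J μ)
    (h2 : Integrable (fun x => J x ^ 2) μ) :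
    ∫ x, (J x - 1) ^ 2 ∂μ = ∫ x, J x ^ 2 ∂μ - 2 * ∫ x, J x ∂μ + 1 := by
  have e : ∀ x, (J x - 1) ^ 2 = J x ^ 2 - 2 * J x + 1 := fun x => by ring
  simp_rw [e]
  have h3 : Integrable (fun x => J x ^ 2 - 2 * J x) μ := h2.sub (h1.const_mul 2)
  rw [integral_add h3 (integrable_const _), integral_sub h2 (h1.const_mul 2), integral_const_mul]
  simp

/-- If the `χ²`-divergence of a single observation is at most `1 / (5 n)`, then the laws of samples
of size `n` share at least half of their mass. -/
theorem exists_common_le_pi {E : Type*} [MeasurableSpace E] {n : ℕ} (μ : Measure E)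
    [IsProbabilityMeasure μ] {J : E → ℝ} {B : ℝ} (hJ : Measurable J) (h0 : ∀ x, 0 ≤ J x)
    (hB : ∀ x, J x ≤ B) (h1 : ∫ x, J x ∂μ = 1) {δ : ℝ} (hδ : ∫ x, (J x - 1) ^ 2 ∂μ ≤ δ)
    (hn : n * δ ≤ 1 / 5) :
    ∃ R : Measure (Fin n → E), R ≤ Measure.pi (fun _ : Fin n => μ) ∧
      R ≤ Measure.pi (fun _ : Fin n => μ.withDensity fun x => ENNReal.ofReal (J x)) ∧
      1 / 2 ≤ R Set.univ := by
  set G : (Fin n → E) → ℝ := fun x => ∏ i, J (x i) with hG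
  have hG0 : ∀ x, 0 ≤ G x := fun x => Finset.prod_nonneg fun i _ => h0 _
  have hint : Integrable J μ :=
    Integrable.of_bound hJ.aestronglyMeasurable B
      (.of_forall fun x => by rw [Real.norm_eq_abs, abs_of_nonneg (h0 x)]; exact hB x)
  have hint2 : Integrable (fun x => J x ^ 2) μ :=
    Integrable.of_bound (hJ.pow_const 2).aestronglyMeasurable (B ^ 2)
      (.of_forall fun x => by
        rw [Real.norm_eq_abs, abs_of_nonneg (sq_nonneg _)]
        exact pow_le_pow_left₀ (h0 x) (hB x) 2)
  have hsq : ∫ x, J x ^ 2 ∂μ ≤ 1 + δ := by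
    rw [integral_sub_one_sq hint hint2, h1] at hδ
    linarith
  have hGi : Integrable G (Measure.pi fun _ : Fin n => μ) :=
    Integrable.fintype_prod (f := fun _ => J) fun _ => hint
  have hGi2 : Integrable (fun x => G x ^ 2) (Measure.pi fun _ : Fin n => μ) := by
    have := Integrable.fintype_prod (μ := fun _ : Fin n => μ) (f := fun _ x => J x ^ 2)
      fun _ => hint2
    refine this.congr (.of_forall fun x => ?_)
    simp [hG, Finset.prod_pow]
  have hG1 : ∫ x, G x ∂(Measure.pi fun _ : Fin n => μ) = 1 := by
    rw [hG, integral_fintype_prod_eq_pow, h1, one_pow]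
  -- The threshold `1 / 5` gives second moment at most `exp (1 / 5) ≤ 5 / 4`, hence variance of the
  -- likelihood ratio at most `1 / 4`.
  have hG2 : ∫ x, G x ^ 2 ∂(Measure.pi fun _ : Fin n => μ) ≤ 5 / 4 := by
    have e : ∀ x, G x ^ 2 = ∏ i, J (x i) ^ 2 := fun x => by simp [hG, Finset.prod_pow]
    simp_rw [e]
    rw [integral_fintype_prod_eq_pow (f := fun x => J x ^ 2), Fintype.card_fin]
    have hδ0 : 0 ≤ δ := (integral_nonneg fun x => sq_nonneg _).trans hδ
    calc (∫ x, J x ^ 2 ∂μ) ^ n ≤ (1 + δ) ^ n :=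
          pow_le_pow_left₀ (integral_nonneg fun x => sq_nonneg _) hsq n
      _ ≤ (Real.exp δ) ^ n := pow_le_pow_left₀ (by linarith) (by
          rw [add_comm]; exact Real.add_one_le_exp δ) n
      _ = Real.exp (n * δ) := (Real.exp_nat_mul δ n).symm
      _ ≤ Real.exp (1 / 5) := Real.exp_le_exp.2 hn
      _ ≤ 5 / 4 := by
          have := Real.one_sub_le_exp_neg (1 / 5)
          rw [Real.exp_neg] at this
          have h2 : (Real.exp (1 / 5))⁻¹ ≥ 4 / 5 := by linarith
          have h3 := Real.exp_pos (1 / 5)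
          have := mul_le_mul_of_nonneg_left h2.le h3.le
          rw [mul_inv_cancel₀ h3.ne'] at this
          linarith
  -- The density `min 1 G` describes the minimum of the two product laws.
  refine ⟨(Measure.pi fun _ : Fin n => μ).withDensity fun x => ENNReal.ofReal (min 1 (G x)),
    ?_, ?_, ?_⟩
  · conv_rhs => rw [← withDensity_one (μ := Measure.pi fun _ : Fin n => μ)]
    refine withDensity_mono (.of_forall fun x => ?_)
    simp
  · rw [pi_withDensity_ofReal μ hJ h0 hB]
    exact withDensity_mono (.of_forall fun x => ENNReal.ofReal_le_ofReal (min_le_right _ _))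
  · rw [withDensity_apply _ MeasurableSet.univ, Measure.restrict_univ]
    have hmi : Integrable (fun x => min 1 (G x)) (Measure.pi fun _ : Fin n => μ) :=
      (integrable_const 1).inf hGi
    rw [← ofReal_integral_eq_lintegral_ofReal hmi
      (.of_forall fun x => le_min zero_le_one (hG0 x))]
    have hlow : (1 : ℝ) / 2 ≤ ∫ x, min 1 (G x) ∂(Measure.pi fun _ : Fin n => μ) := by
      -- The bound by `G` is `(G - 1/2)² ≥ 0` rearranged. Integrating leaves at least `3/4 - 1/4`.
      have hle : ∀ x, 3 / 4 - (G x - 1) ^ 2 ≤ min 1 (G x) := by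
        intro x
        refine le_min ?_ ?_ <;> nlinarith [sq_nonneg (G x - 1), sq_nonneg (G x - 1 / 2)]
      have hi3 : Integrable (fun x => (G x - 1) ^ 2) (Measure.pi fun _ : Fin n => μ) :=
        ((hGi2.sub (hGi.const_mul 2)).add (integrable_const 1)).congr
          (.of_forall fun x => by simp only [Pi.add_apply, Pi.sub_apply]; ring)
      have := integral_mono ((integrable_const (3 / 4 : ℝ)).sub hi3) hmi hle
      simp only [Pi.sub_apply] at this
      rw [integral_sub (integrable_const _) hi3, integral_sub_one_sq hGi hGi2, hG1] at this
      simp at this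
      linarith
    have := ENNReal.ofReal_le_ofReal hlow
    rwa [ENNReal.ofReal_div_of_pos two_pos, ENNReal.ofReal_one, ENNReal.ofReal_ofNat] at this

/-- The mass shared by two samples survives a measurable transformation of the observations and
the addition of independent noise. -/
theorem exists_common_le_pi_conv {E F : Type*} [MeasurableSpace E] [MeasurableSpace F] [AddMonoid F]
    [MeasurableAdd₂ F] {n : ℕ} (μ : Measure E)
    [IsProbabilityMeasure μ] (γ : Measure F) [IsProbabilityMeasure γ] {g : E → F}
    (hg : Measurable g) {J : E → ℝ} {B : ℝ} (hJ : Measurable J) (h0 : ∀ x, 0 ≤ J x)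
    (hB : ∀ x, J x ≤ B) (h1 : ∫ x, J x ∂μ = 1) {δ : ℝ} (hδ : ∫ x, (J x - 1) ^ 2 ∂μ ≤ δ)
    (hn : n * δ ≤ 1 / 5) :
    ∃ R : Measure (Fin n → F), R ≤ Measure.pi (fun _ : Fin n => (μ.map g).conv γ) ∧
      R ≤ Measure.pi (fun _ : Fin n =>
        ((μ.withDensity fun x => ENNReal.ofReal (J x)).map g).conv γ) ∧
      1 / 2 ≤ R Set.univ := by
  have hint : Integrable J μ :=
    Integrable.of_bound hJ.aestronglyMeasurable B
      (.of_forall fun x => by rw [Real.norm_eq_abs, abs_of_nonneg (h0 x)]; exact hB x)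
  have hfin : IsFiniteMeasure (μ.withDensity fun x => ENNReal.ofReal (J x)) :=
    isFiniteMeasure_withDensity_ofReal hint.2
  have hH : Measurable fun p : E × F => g p.1 + p.2 :=
    (hg.comp measurable_fst).add measurable_snd
  have hconv : ∀ ν : Measure E, IsFiniteMeasure ν →
      (ν.map g).conv γ = (ν.prod γ).map fun p => g p.1 + p.2 := by
    intro ν _
    rw [Measure.conv]
    conv_lhs => rw [← Measure.map_id (μ := γ)]
    rw [Measure.map_prod_map _ _ hg measurable_id, Measure.map_map measurable_add
      (hg.prodMap measurable_id)]
    rfl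
  have hpi : ∀ ν : Measure E, IsFiniteMeasure ν →
      Measure.pi (fun _ : Fin n => (ν.map g).conv γ) =
        (Measure.pi fun _ : Fin n => ν.prod γ).map fun x i => g (x i).1 + (x i).2 := by
    intro ν _
    rw [hconv ν ‹_›]
    have : IsFiniteMeasure ((ν.prod γ).map fun p => g p.1 + p.2) := inferInstance
    exact (Measure.pi_map_pi (μ := fun _ : Fin n => ν.prod γ)
      (f := fun _ p => g p.1 + p.2) fun _ => hH.aemeasurable).symm
  have hm : Measurable fun (x : Fin n → E × F) i => g (x i).1 + (x i).2 := by
    exact measurable_pi_lambda _ fun i => hH.comp (measurable_pi_apply i)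
  have hfst : ∀ f : E → ℝ, ∫ p, f p.1 ∂(μ.prod γ) = ∫ x, f x ∂μ := by
    intro f
    rw [integral_fun_fst]; simp
  -- Noise is an extra independent coordinate on which the density does not depend. The common part
  -- is found for the pairs (latent point, noise) and then pushed forward, which preserves
  -- domination and total mass.
  obtain ⟨R, hR1, hR2, hR3⟩ := exists_common_le_pi (n := n) (μ.prod γ) (J := fun p => J p.1)
    (hJ.comp measurable_fst) (fun p => h0 _) (fun p => hB _) (by rw [hfst, h1])
    (δ := δ) (by rw [hfst fun x => (J x - 1) ^ 2]; exact hδ) hn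
  refine ⟨R.map fun x i => g (x i).1 + (x i).2, ?_, ?_, ?_⟩
  · rw [hpi μ inferInstance]; exact Measure.map_mono hR1 hm
  · rw [hpi _ hfin, prod_withDensity_left (by fun_prop)]; exact Measure.map_mono hR2 hm
  · rwa [Measure.map_apply hm MeasurableSet.univ, Set.preimage_univ]

/-! ### Le Cam's and Assouad's lemmas -/

/-- Le Cam's two-point bound: no statistic is close to `θ₀` under `P₀` and to `θ₁` under `P₁` if the
two measures share half of their mass. -/
theorem two_point_bound {X : Type*} [MeasurableSpace X] {P₀ P₁ R : Measure X} (h0 : R ≤ P₀)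
    (h1 : R ≤ P₁) (hR : 1 / 2 ≤ R Set.univ) {T : X → ℝ} (hT : Measurable T) (θ₀ θ₁ : ℝ) :
    ENNReal.ofReal |θ₁ - θ₀| / 2 ≤ ∫⁻ x, ENNReal.ofReal |T x - θ₀| ∂P₀ +
      ∫⁻ x, ENNReal.ofReal |T x - θ₁| ∂P₁ := by
  calc ENNReal.ofReal |θ₁ - θ₀| / 2 ≤ ENNReal.ofReal |θ₁ - θ₀| * R Set.univ := by
        rw [← mul_one_div]; gcongr
    _ = ∫⁻ _, ENNReal.ofReal |θ₁ - θ₀| ∂(R) := (lintegral_const _).symm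
    _ ≤ ∫⁻ x, (ENNReal.ofReal |T x - θ₀| + ENNReal.ofReal |T x - θ₁|) ∂(R) := by
        refine lintegral_mono fun x => ?_
        rw [← ENNReal.ofReal_add (abs_nonneg _) (abs_nonneg _)]
        refine ENNReal.ofReal_le_ofReal ?_
        have := abs_sub_le θ₁ (T x) θ₀
        rw [abs_sub_comm θ₁ (T x)] at this
        linarith
    _ = ∫⁻ x, ENNReal.ofReal |T x - θ₀| ∂(R) + ∫⁻ x, ENNReal.ofReal |T x - θ₁| ∂(R) :=
        lintegral_add_left (by fun_prop) _
    _ ≤ _ := by gcongr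

/-- Flipping coordinate `j` is an involution of the hypercube, so summing the two-point inequality
over all vertices counts every value of `f` twice. -/
theorem sum_le_two_mul_sum_update {I : Type*} [Fintype I] [DecidableEq I] (f : (I → Bool) → ℝ≥0∞)
    (j : I) (c : ℝ≥0∞)
    (h : ∀ ε : I → Bool, ε j = false → c ≤ f ε + f (Function.update ε j true)) :
    Fintype.card (I → Bool) * c ≤ 2 * ∑ ε, f ε := by
  let e : (I → Bool) ≃ (I → Bool) :=
    Function.Involutive.toPerm (fun ε => Function.update ε j (!ε j)) fun ε => by simp
  have he : ∀ ε, e ε = Function.update ε j (!ε j) := fun ε => rfl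
  have hle : ∀ ε, c ≤ f ε + f (e ε) := by
    intro ε
    rw [he]
    rcases hε : ε j with _ | _
    · simpa using h ε hε
    · have := h (Function.update ε j false) (by simp)
      rw [Function.update_idem, ← hε, Function.update_eq_self, add_comm] at this
      simpa [hε] using this
  calc (Fintype.card (I → Bool) : ℝ≥0∞) * c = ∑ _ : I → Bool, c := by simp
    _ ≤ ∑ ε, (f ε + f (e ε)) := Finset.sum_le_sum fun ε _ => hle ε
    _ = 2 * ∑ ε, f ε := by rw [Finset.sum_add_distrib, Equiv.sum_comp e f, two_mul]

/-- **Assouad's lemma** for sums of coordinatewise losses. -/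
theorem assouad {I X : Type*} [Fintype I] [DecidableEq I] [MeasurableSpace X]
    (P : (I → Bool) → Measure X)
    (hP : ∀ ε j, ε j = false → ∃ R : Measure X, R ≤ P ε ∧ R ≤ P (Function.update ε j true) ∧
      1 / 2 ≤ R Set.univ)
    {T : I → X → ℝ} (hT : ∀ j, Measurable (T j)) (θ : I → Bool → ℝ) (Δ : ℝ)
    (hΔ : ∀ j, Δ ≤ |θ j true - θ j false|) :
    ∃ ε, ENNReal.ofReal (Fintype.card I * Δ / 4) ≤
      ∫⁻ x, ∑ j, ENNReal.ofReal |T j x - θ j (ε j)| ∂(P ε) := by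
  -- Averaging over vertices: each coordinate contributes at least `Δ / 4` to the average loss (`Δ /
  -- 2` per flipped pair), so not all vertices can lie below the claimed bound.
  by_contra! hcon
  have hcard : (Fintype.card (I → Bool) : ℝ≥0∞) ≠ 0 := by
    simp
  have key : ∀ j, (Fintype.card (I → Bool) : ℝ≥0∞) * (ENNReal.ofReal Δ / 2) ≤
      2 * ∑ ε, ∫⁻ x, ENNReal.ofReal |T j x - θ j (ε j)| ∂(P ε) := by
    intro j
    refine sum_le_two_mul_sum_update _ j _ fun ε hε => ?_
    obtain ⟨R, h0, h1, hR⟩ := hP ε j hε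
    refine le_trans ?_ ((two_point_bound h0 h1 hR (hT j) (θ j false) (θ j true)).trans_eq ?_)
    · gcongr; exact hΔ j
    · simp [hε]
  have hsum : ∑ j : I, (Fintype.card (I → Bool) : ℝ≥0∞) * (ENNReal.ofReal Δ / 2) ≤
      2 * ∑ ε, ∫⁻ x, ∑ j, ENNReal.ofReal |T j x - θ j (ε j)| ∂(P ε) := by
    refine (Finset.sum_le_sum fun j _ => key j).trans_eq ?_
    rw [← Finset.mul_sum, Finset.sum_comm]
    congr 1
    refine Finset.sum_congr rfl fun ε _ => ?_
    rw [lintegral_finsetSum _ fun j _ => by have := hT j; fun_prop]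
  have hlt : ∑ ε, ∫⁻ x, ∑ j, ENNReal.ofReal |T j x - θ j (ε j)| ∂(P ε) <
      ∑ _ε : I → Bool, ENNReal.ofReal (Fintype.card I * Δ / 4) :=
    ENNReal.sum_lt_sum_of_nonempty Finset.univ_nonempty fun ε _ => hcon ε
  have h2 := ENNReal.mul_lt_mul_right (a := 2) (by norm_num) (by norm_num) hlt
  refine absurd (hsum.trans_lt h2) (not_lt.2 (le_of_eq ?_))
  have e1 : ENNReal.ofReal (Fintype.card I * Δ / 4) =
      Fintype.card I * (ENNReal.ofReal Δ / 2) / 2 := by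
    rw [← ENNReal.ofReal_natCast, ← ENNReal.ofReal_ofNat 2, ← ENNReal.ofReal_div_of_pos two_pos,
      ← ENNReal.ofReal_mul (by positivity), ← ENNReal.ofReal_div_of_pos two_pos]
    congr 1; ring
  rw [e1, Finset.sum_const, Finset.sum_const, Finset.card_univ, Finset.card_univ, nsmul_eq_mul,
    nsmul_eq_mul]
  have e2 : ∀ y : ℝ≥0∞, 2 * (y / 2) = y := fun y => ENNReal.mul_div_cancel (by simp) (by simp)
  rw [mul_left_comm, e2]
  ring

/-! ### From Wasserstein loss to coordinatewise losses -/

/-- Nonnegative Lipschitz functions with disjoint supports: the sum of the differences of their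
integrals bounds the Wasserstein distance from below. -/
theorem sum_integral_sub_le_wasserstein1 {I : Type*} [Fintype I] [DecidableEq I] {D : ℕ}
    {φ : I → EuclideanSpace ℝ (Fin D) → ℝ} (hL : ∀ j, LipschitzWith 1 (φ j)) {B : ℝ}
    (hB : ∀ j x, |φ j x| ≤ B)
    (hdisj : ∀ x i j, φ i x ≠ 0 → φ j x ≠ 0 → i = j) (μ ν : Measure (EuclideanSpace ℝ (Fin D)))
    [IsProbabilityMeasure μ] [IsProbabilityMeasure ν] :
    ∑ j, ENNReal.ofReal |∫ x, φ j x ∂μ - ∫ x, φ j x ∂ν| ≤ 2 * wasserstein1 μ ν := by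
  rw [mul_comm, ← ENNReal.div_le_iff (by simp) (by simp)]
  refine le_iInf fun π => le_iInf fun hπ => ?_
  rw [ENNReal.div_le_iff (by simp) (by simp), mul_comm]
  obtain ⟨rfl, rfl⟩ := hπ
  have : IsProbabilityMeasure π := by
    constructor
    have := measure_univ (μ := π.map Prod.fst)
    rwa [Measure.map_apply measurable_fst MeasurableSet.univ] at this
  have hc : ∀ j, Continuous (φ j) := fun j => (hL j).continuous
  have hi : ∀ j, ∀ p : EuclideanSpace ℝ (Fin D) × EuclideanSpace ℝ (Fin D) →
      EuclideanSpace ℝ (Fin D), Continuous p → Integrable (fun z => φ j (p z)) π := fun j p hp =>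
    Integrable.of_bound ((hc j).comp hp).aestronglyMeasurable B (.of_forall fun z => hB j _)
  -- At a pair `(x, y)` at most one test function is nonzero at `x` and at most one at `y`. This is
  -- the origin of the factor 2.
  have hpt : ∀ x y, ∑ j, |φ j x - φ j y| ≤ 2 * dist x y := by
    intro x y
    have hz : ∀ z, ∃ s : Finset I, s.card ≤ 1 ∧ ∀ j ∉ s, φ j z = 0 := by
      intro z
      refine ⟨Finset.univ.filter fun j => φ j z ≠ 0, Finset.card_le_one.2 fun i hi j hj => ?_,
        fun j hj => by simpa using hj⟩
      simp only [Finset.mem_filter, Finset.mem_univ, true_and] at hi hj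
      exact hdisj z i j hi hj
    obtain ⟨s, hs, hs'⟩ := hz x
    obtain ⟨t, ht, ht'⟩ := hz y
    rw [← Finset.sum_subset (Finset.subset_univ (s ∪ t)) fun j _ hj => by
      rw [Finset.mem_union, not_or] at hj
      rw [hs' j hj.1, ht' j hj.2]; simp]
    calc ∑ j ∈ s ∪ t, |φ j x - φ j y| ≤ ∑ j ∈ s ∪ t, dist x y := by
          refine Finset.sum_le_sum fun j _ => ?_
          have := (hL j).dist_le_mul x y
          rwa [Real.dist_eq, NNReal.coe_one, one_mul] at this
      _ = (s ∪ t).card * dist x y := by rw [Finset.sum_const, nsmul_eq_mul]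
      _ ≤ 2 * dist x y := by
          gcongr
          have := Finset.card_union_le s t
          exact_mod_cast this.trans (by omega)
  calc ∑ j, ENNReal.ofReal |∫ x, φ j x ∂(π.map Prod.fst) - ∫ x, φ j x ∂(π.map Prod.snd)|
      ≤ ∑ j, ∫⁻ z, ENNReal.ofReal |φ j z.1 - φ j z.2| ∂π := by
        refine Finset.sum_le_sum fun j _ => ?_
        have hd : Integrable (fun z => |φ j z.1 - φ j z.2|) π :=
          ((hi j _ continuous_fst).sub (hi j _ continuous_snd)).abs
        rw [integral_map measurable_fst.aemeasurable (hc j).aestronglyMeasurable,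
          integral_map measurable_snd.aemeasurable (hc j).aestronglyMeasurable,
          ← integral_sub (hi j _ continuous_fst) (hi j _ continuous_snd),
          ← ofReal_integral_eq_lintegral_ofReal hd (.of_forall fun z => abs_nonneg _)]
        exact ENNReal.ofReal_le_ofReal (abs_integral_le_integral_abs)
    _ = ∫⁻ z, ∑ j, ENNReal.ofReal |φ j z.1 - φ j z.2| ∂π := by
        rw [lintegral_finsetSum]
        intro j _
        have := (hc j).measurable
        fun_prop
    _ ≤ ∫⁻ z, 2 * edist z.1 z.2 ∂π := by
        refine lintegral_mono fun z => ?_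
        rw [← ENNReal.ofReal_sum_of_nonneg fun j _ => abs_nonneg _, edist_dist]
        refine (ENNReal.ofReal_le_ofReal (hpt _ _)).trans_eq ?_
        rw [ENNReal.ofReal_mul two_pos.le, ENNReal.ofReal_ofNat]
    _ = 2 * ∫⁻ z, edist z.1 z.2 ∂π := lintegral_const_mul _ (by fun_prop)

theorem Measurable.integral_of_nonneg {X Y : Type*} [MeasurableSpace X] [MeasurableSpace Y]
    {κ : X → Measure Y} (hκ : Measurable κ) {f : Y → ℝ} (hf : Measurable f) (h0 : ∀ y, 0 ≤ f y) :
    Measurable fun x => ∫ y, f y ∂(κ x) := by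
  have e : (fun x => ∫ y, f y ∂(κ x)) = fun x => (∫⁻ y, ENNReal.ofReal (f y) ∂(κ x)).toReal :=
    funext fun x => integral_eq_lintegral_of_nonneg_ae (.of_forall h0) hf.aestronglyMeasurable
  rw [e]
  exact ((Measure.measurable_lintegral (by fun_prop)).comp hκ).ennreal_toReal

/-- Lower bound for the Wasserstein minimax risk from a hypercube of generators. -/
theorem le_wassersteinMinimaxRisk {I : Type*} [Fintype I] [DecidableEq I] {d D n : ℕ}
    {G : Set (EuclideanSpace ℝ (Fin d) → EuclideanSpace ℝ (Fin D))} {σ : ℝ}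
    (g : (I → Bool) → EuclideanSpace ℝ (Fin d) → EuclideanSpace ℝ (Fin D)) (hg : ∀ ε, g ε ∈ G)
    (hprob : ∀ ε, IsProbabilityMeasure (generatedLaw (g ε)))
    (hR : ∀ ε j, ε j = false → ∃ R : Measure (Fin n → EuclideanSpace ℝ (Fin D)),
      R ≤ Measure.pi (fun _ => dataLaw (g ε) σ) ∧
      R ≤ Measure.pi (fun _ => dataLaw (g (Function.update ε j true)) σ) ∧ 1 / 2 ≤ R Set.univ)
    {φ : I → EuclideanSpace ℝ (Fin D) → ℝ} (hL : ∀ j, LipschitzWith 1 (φ j)) {B : ℝ}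
    (hφ0 : ∀ j x, 0 ≤ φ j x) (hB : ∀ j x, φ j x ≤ B)
    (hdisj : ∀ x i j, φ i x ≠ 0 → φ j x ≠ 0 → i = j)
    (θ : I → Bool → ℝ) (hθ : ∀ ε j, ∫ x, φ j x ∂(generatedLaw (g ε)) = θ j (ε j)) (Δ : ℝ)
    (hΔ : ∀ j, Δ ≤ |θ j true - θ j false|) :
    ENNReal.ofReal (Fintype.card I * Δ / 8) ≤ wassersteinMinimaxRisk G σ n := by
  refine le_iInf fun Q => le_iInf fun hQ => ?_
  -- Integrating `φ j` against the estimated law turns an estimator of distributions into real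
  -- statistics, one for each bit.
  obtain ⟨ε, hε⟩ := assouad (fun ε => Measure.pi fun _ : Fin n => dataLaw (g ε) σ) hR
    (T := fun j x => ∫ y, φ j y ∂(Q x))
    (fun j => hQ.1.integral_of_nonneg (hL j).continuous.measurable (hφ0 j)) θ Δ hΔ
  refine le_trans ?_ (le_iSup₂ (g ε) (hg ε))
  have e : ENNReal.ofReal (Fintype.card I * Δ / 8) =
      ENNReal.ofReal (Fintype.card I * Δ / 4) / 2 := by
    rw [← ENNReal.ofReal_ofNat 2, ← ENNReal.ofReal_div_of_pos two_pos]
    congr 1; ring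
  rw [e]
  refine ENNReal.div_le_of_le_mul (hε.trans ?_)
  rw [mul_comm, ← lintegral_const_mul' _ _ (by simp)]
  refine lintegral_mono fun x => ?_
  have := hQ.2 x
  have := hprob ε
  simp_rw [← hθ ε]
  exact sum_integral_sub_le_wasserstein1 hL
    (fun j y => by rw [abs_of_nonneg (hφ0 j y)]; exact hB j y) hdisj _ _

/-! ### Hölder bounds -/

/-- Operator-norm version of a bound `B` for the Hölder norm of order `s + α`. -/
def HolderBoundOn {d : ℕ} (s : ℕ) (α : ℝ) (A : Set (EuclideanSpace ℝ (Fin d))) (B : ℝ)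
    (f : EuclideanSpace ℝ (Fin d) → ℝ) : Prop :=
  ContDiff ℝ s f ∧ (∀ j ≤ s, ∀ x ∈ A, ‖iteratedFDeriv ℝ j f x‖ ≤ B) ∧
    ∀ x ∈ A, ∀ y ∈ A, ‖iteratedFDeriv ℝ s f x - iteratedFDeriv ℝ s f y‖ ≤ B * ‖x - y‖ ^ α

namespace HolderBoundOn

variable {d s : ℕ} {α : ℝ} {A : Set (EuclideanSpace ℝ (Fin d))} {B B' : ℝ}
  {f f' : EuclideanSpace ℝ (Fin d) → ℝ}

theorem mono (h : HolderBoundOn s α A B f) (hB : B ≤ B') : HolderBoundOn s α A B' f :=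
  ⟨h.1, fun j hj x hx => (h.2.1 j hj x hx).trans hB, fun x hx y hy =>
    (h.2.2 x hx y hy).trans (mul_le_mul_of_nonneg_right hB (by positivity))⟩

theorem add (h : HolderBoundOn s α A B f) (h' : HolderBoundOn s α A B' f') :
    HolderBoundOn s α A (B + B') (f + f') := by
  have e : ∀ j ≤ s, ∀ x, iteratedFDeriv ℝ j (f + f') x =
      iteratedFDeriv ℝ j f x + iteratedFDeriv ℝ j f' x := fun j hj x =>
    iteratedFDeriv_add_apply ((h.1.of_le (by exact_mod_cast hj)).contDiffAt)
      ((h'.1.of_le (by exact_mod_cast hj)).contDiffAt)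
  refine ⟨h.1.add h'.1, fun j hj x hx => ?_, fun x hx y hy => ?_⟩
  · rw [e j hj]
    exact (norm_add_le _ _).trans (add_le_add (h.2.1 j hj x hx) (h'.2.1 j hj x hx))
  · rw [e s le_rfl, e s le_rfl, add_sub_add_comm, add_mul]
    exact (norm_add_le _ _).trans (add_le_add (h.2.2 x hx y hy) (h'.2.2 x hx y hy))

/-- Partial derivatives are values of the iterated derivative at unit vectors, so `B` bounds each of
the two suprema; `holderNorm` adds them, whence `2 * B`. -/
theorem mem_holderBall {β K : ℝ}
    (h : HolderBoundOn (holderOrder β) (β - holderOrder β) A B f) (hK : 2 * B ≤ K) (hB : 0 ≤ B) :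
    f ∈ holderBall β K A := by
  have hp : ∀ {j : ℕ} (i : Fin j → Fin d)
      (L : ContinuousMultilinearMap ℝ (fun _ : Fin j => EuclideanSpace ℝ (Fin d)) ℝ),
      |L fun l => EuclideanSpace.single (i l) (1 : ℝ)| ≤ ‖L‖ := by
    intro j i L
    have := L.le_opNorm fun l => EuclideanSpace.single (i l) (1 : ℝ)
    simpa using this
  refine ⟨h.1.continuous.continuousOn, h.1.contDiffOn, ?_⟩
  have h2 : ENNReal.ofReal K ≥ ENNReal.ofReal B + ENNReal.ofReal B := by
    rw [← ENNReal.ofReal_add hB hB]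
    exact ENNReal.ofReal_le_ofReal (by linarith)
  refine le_trans (add_le_add ?_ ?_) h2
  · refine iSup_le fun j => iSup_le fun hj => iSup_le fun i => iSup_le fun x => iSup_le fun hx => ?_
    exact ENNReal.ofReal_le_ofReal ((hp i _).trans (h.2.1 j hj x (interior_subset hx)))
  · refine iSup_le fun i => iSup_le fun x => iSup_le fun hx => iSup_le fun y => iSup_le fun hy =>
      iSup_le fun hxy => ENNReal.ofReal_le_ofReal ?_
    have hpos : 0 < ‖x - y‖ := norm_pos_iff.2 (sub_ne_zero.2 hxy)
    rw [div_le_iff₀ (Real.rpow_pos_of_pos hpos _)]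
    refine le_trans ?_ (h.2.2 x (interior_subset hx) y (interior_subset hy))
    have := hp i (iteratedFDeriv ℝ (holderOrder β) f x - iteratedFDeriv ℝ (holderOrder β) f y)
    simpa [partialDeriv] using this

/-- Interpolation: derivative bounds at scale `h` give a Hölder bound at scale `h`. -/
theorem of_derivative_bounds (hA : Convex ℝ A) (hα0 : 0 < α) (hα1 : α ≤ 1) {h M : ℝ} (hh : 0 < h)
    (hh1 : h ≤ 1) (hM : 0 ≤ M) (hf : ContDiff ℝ (s + 1 : ℕ) f)
    (hb : ∀ j ≤ s + 1, ∀ x ∈ A, ‖iteratedFDeriv ℝ j f x‖ ≤ M * h ^ (-(j : ℝ))) :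
    HolderBoundOn s α A (2 * (M * h ^ (-(s + α)))) f := by
  have hmono : ∀ j ≤ s, h ^ (-(j : ℝ)) ≤ h ^ (-(s + α)) := fun j hj => by
    refine Real.rpow_le_rpow_of_exponent_ge hh hh1 ?_
    have : (j : ℝ) ≤ s := by exact_mod_cast hj
    linarith
  refine ⟨hf.of_le (by exact_mod_cast Nat.le_succ s), fun j hj x hx => ?_, fun x hx y hy => ?_⟩
  · refine (hb j (by omega) x hx).trans ?_
    have := mul_le_mul_of_nonneg_left (hmono j hj) hM
    have h0 : 0 ≤ M * h ^ (-(s + α)) := by positivity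
    linarith
  · rcases eq_or_ne x y with rfl | hxy
    · simp [hα0.ne']
    have hr : 0 < ‖x - y‖ := norm_pos_iff.2 (sub_ne_zero.2 hxy)
    -- Points at distance at least `h` are handled by the triangle inequality, closer ones by the
    -- mean value inequality with the derivative of order `s + 1`.
    rcases le_total h ‖x - y‖ with hle | hle
    · have h1 : ‖iteratedFDeriv ℝ s f x - iteratedFDeriv ℝ s f y‖ ≤ 2 * (M * h ^ (-(s : ℝ))) := by
        refine (norm_sub_le _ _).trans ?_
        have := hb s (by omega) x hx
        have := hb s (by omega) y hy
        linarith
      refine h1.trans ?_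
      have e : h ^ (-(s : ℝ)) = h ^ (-(s + α)) * h ^ α := by
        rw [← Real.rpow_add hh]; congr 1; ring
      rw [e, mul_assoc, mul_assoc]
      have := Real.rpow_le_rpow hh.le hle hα0.le
      gcongr
    · have h1 : ‖iteratedFDeriv ℝ s f x - iteratedFDeriv ℝ s f y‖ ≤
          M * h ^ (-((s + 1 : ℕ) : ℝ)) * ‖x - y‖ := by
        refine hA.norm_image_sub_le_of_norm_fderiv_le (𝕜 := ℝ) (fun z _ => ?_) (fun z hz => ?_) hy hx
        · exact (hf.differentiable_iteratedFDeriv (by exact_mod_cast Nat.lt_succ_self s)) z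
        · rw [norm_fderiv_iteratedFDeriv]; exact hb _ le_rfl z hz
      refine h1.trans ?_
      have e : h ^ (-((s + 1 : ℕ) : ℝ)) = h ^ (-(s + α)) * h ^ (-(1 - α)) := by
        rw [← Real.rpow_add hh]; congr 1; push_cast; ring
      have e2 : ‖x - y‖ = ‖x - y‖ ^ (1 - α) * ‖x - y‖ ^ α := by
        rw [← Real.rpow_add hr]; simp
      have h3 : h ^ (-(1 - α)) * ‖x - y‖ ^ (1 - α) ≤ 1 := by
        rw [Real.rpow_neg hh.le, inv_mul_le_one₀ (by positivity)]
        exact Real.rpow_le_rpow hr.le hle (by linarith)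
      have h4 : 0 ≤ M * h ^ (-(s + α)) * ‖x - y‖ ^ α := by positivity
      calc M * h ^ (-((s + 1 : ℕ) : ℝ)) * ‖x - y‖
          = M * h ^ (-(s + α)) * ‖x - y‖ ^ α * (h ^ (-(1 - α)) * ‖x - y‖ ^ (1 - α)) := by
            rw [e]; conv_lhs => rw [e2]
            ring
        _ ≤ M * h ^ (-(s + α)) * ‖x - y‖ ^ α * 1 := by gcongr
        _ ≤ _ := by linarith

theorem exists_of_contDiff (hA : Convex ℝ A) (hAc : IsCompact A) (hα0 : 0 < α) (hα1 : α ≤ 1)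
    (hf : ContDiff ℝ (s + 1 : ℕ) f) : ∃ B, 0 ≤ B ∧ HolderBoundOn s α A B f := by
  have : ∀ j ≤ s + 1, ∃ M, ∀ x ∈ A, ‖iteratedFDeriv ℝ j f x‖ ≤ M := fun j hj =>
    hAc.exists_bound_of_continuousOn
      (hf.continuous_iteratedFDeriv (by exact_mod_cast hj)).continuousOn
  choose! M hM using this
  refine ⟨2 * ((∑ j ∈ Finset.range (s + 2), |M j|) * 1 ^ (-(s + α))), by positivity,
    of_derivative_bounds hA hα0 hα1 one_pos le_rfl
    (Finset.sum_nonneg fun j _ => abs_nonneg _) hf fun j hj x hx => ?_⟩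
  rw [Real.one_rpow, mul_one]
  exact ((hM j hj x hx).trans (le_abs_self _)).trans
    (Finset.single_le_sum (f := fun j => |M j|) (fun j _ => abs_nonneg _)
      (Finset.mem_range.2 (by omega)))

end HolderBoundOn

theorem holderOrder_lt {β : ℝ} (hβ : 0 < β) : (holderOrder β : ℝ) < β := by
  have h1 : 1 ≤ ⌈β⌉₊ := Nat.one_le_iff_ne_zero.2 (Nat.ceil_pos.2 hβ).ne'
  have := Nat.ceil_lt_add_one hβ.le
  rw [holderOrder, Nat.cast_sub h1]
  push_cast; linarith

theorem sub_holderOrder_le_one {β : ℝ} (hβ : 0 < β) : β - holderOrder β ≤ 1 := by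
  have h1 : 1 ≤ ⌈β⌉₊ := Nat.one_le_iff_ne_zero.2 (Nat.ceil_pos.2 hβ).ne'
  have := Nat.le_ceil β
  rw [holderOrder, Nat.cast_sub h1]
  push_cast; linarith

/-! ### Rescaled bumps -/

/-- A fixed smooth bump function supported in the ball of radius `1 / 16` around the origin. -/
def unitBump (d : ℕ) : ContDiffBump (0 : EuclideanSpace ℝ (Fin d)) where
  rIn := 1 / 32
  -- After rescaling the bump lives within `h / 16` of the centre. With `a ≤ 1 / 16` it moves points
  -- by at most `h / 16`, so they stay within `h / 8`, where `cellTest` is affine.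
  rOut := 1 / 16
  rIn_pos := by norm_num
  rIn_lt_rOut := by norm_num

theorem exists_bound_iteratedFDeriv_unitBump (d N : ℕ) :
    ∃ B, 1 ≤ B ∧ ∀ j ≤ N, ∀ x, ‖iteratedFDeriv ℝ j (unitBump d) x‖ ≤ B := by
  have : ∀ j : ℕ, ∃ M, ∀ x, ‖iteratedFDeriv ℝ j (unitBump d) x‖ ≤ M := fun j =>
    ((unitBump d).contDiff (n := j)).continuous_iteratedFDeriv le_rfl
      |>.bounded_above_of_compact_support ((unitBump d).hasCompactSupport.iteratedFDeriv j)
  choose M hM using this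
  refine ⟨1 + ∑ j ∈ Finset.range (N + 1), |M j|,
    le_add_of_nonneg_right (Finset.sum_nonneg fun j _ => abs_nonneg _), fun j hj x => ?_⟩
  have := Finset.single_le_sum (f := fun j => |M j|) (fun j _ => abs_nonneg _)
      (Finset.mem_range.2 (Nat.lt_succ_of_le hj))
  have := (hM j x).trans (le_abs_self _)
  linarith

/-- The bump function rescaled to a cell of side `h` with centre `c`, with relative height `a`. -/
def cellBump {d : ℕ} (a h : ℝ) (c z : EuclideanSpace ℝ (Fin d)) : ℝ :=
  a * h * unitBump d (h⁻¹ • (z - c))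

section cellBump

variable {d : ℕ} {a h : ℝ} (c : EuclideanSpace ℝ (Fin d))

theorem contDiff_cellBump (n : ℕ∞) : ContDiff ℝ n (cellBump a h c) :=
  contDiff_const.mul ((unitBump d).contDiff.comp
    (g := unitBump d) (f := fun z => h⁻¹ • (z - c)) (by fun_prop))

theorem cellBump_nonneg (ha : 0 ≤ a) (hh : 0 ≤ h) (z) : 0 ≤ cellBump a h c z :=
  mul_nonneg (mul_nonneg ha hh) (unitBump d).nonneg

theorem cellBump_le (ha : 0 ≤ a) (hh : 0 ≤ h) (z) : cellBump a h c z ≤ a * h :=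
  mul_le_of_le_one_right (mul_nonneg ha hh) (unitBump d).le_one

theorem cellBump_eq_zero (hh : 0 < h) {z} (hz : h / 16 ≤ dist z c) : cellBump a h c z = 0 := by
  have : unitBump d (h⁻¹ • (z - c)) = 0 := by
    refine (unitBump d).zero_of_le_dist ?_
    rw [dist_zero_right, norm_smul, norm_inv, Real.norm_of_nonneg hh.le, ← dist_eq_norm,
      inv_mul_eq_div, le_div_iff₀ hh]
    show 1 / 16 * h ≤ _
    linarith
  rw [cellBump, this, mul_zero]

/-- Each derivative of the rescaled bump costs a factor `h⁻¹`. -/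
theorem norm_iteratedFDeriv_cellBump_le (ha : 0 ≤ a) (hh : 0 < h) {B : ℝ} {j : ℕ}
    (hB : ∀ x, ‖iteratedFDeriv ℝ j (unitBump d) x‖ ≤ B) (z) :
    ‖iteratedFDeriv ℝ j (cellBump a h c) z‖ ≤ a * h * B * h ^ (-(j : ℝ)) := by
  have e : cellBump a h c = (a * h) • fun z => (unitBump d ∘
      ((h⁻¹ • ContinuousLinearMap.id ℝ (EuclideanSpace ℝ (Fin d))))) (z - c) := by
    ext z; simp [cellBump]
  have hs : ContDiff ℝ j (unitBump d ∘
      ((h⁻¹ • ContinuousLinearMap.id ℝ (EuclideanSpace ℝ (Fin d))))) :=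
    (unitBump d).contDiff.comp (ContinuousLinearMap.contDiff _)
  have hs' : ContDiff ℝ j fun z => (unitBump d ∘
      ((h⁻¹ • ContinuousLinearMap.id ℝ (EuclideanSpace ℝ (Fin d))))) (z - c) :=
    hs.comp (f := fun z => z - c) (by fun_prop)
  rw [e, iteratedFDeriv_const_smul_apply hs'.contDiffAt, norm_smul,
    Real.norm_of_nonneg (by positivity), iteratedFDeriv_comp_sub,
    ContinuousLinearMap.iteratedFDeriv_comp_right _ (unitBump d).contDiff _ le_rfl, mul_assoc (a * h)]
  refine mul_le_mul_of_nonneg_left ?_ (by positivity)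
  refine le_trans (ContinuousMultilinearMap.norm_compContinuousLinearMap_le _ _) ?_
  refine mul_le_mul (hB _) ?_ (by positivity) ((norm_nonneg _).trans (hB 0))
  rw [Finset.prod_const, Finset.card_univ, Fintype.card_fin, Real.rpow_neg hh.le,
    Real.rpow_natCast, ← inv_pow]
  gcongr
  rw [norm_smul, norm_inv, Real.norm_of_nonneg hh.le]
  exact mul_le_of_le_one_right (by positivity) ContinuousLinearMap.norm_id_le

theorem tsupport_cellBump_subset (hh : 0 < h) :
    tsupport (cellBump a h c) ⊆ Metric.closedBall c (h / 16) := by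
  refine closure_minimal (fun z hz => ?_) Metric.isClosed_closedBall
  by_contra hzc
  rw [Metric.mem_closedBall, not_le] at hzc
  exact hz (cellBump_eq_zero c hh hzc.le)

end cellBump

/-- At every point at most one summand has a nonzero derivative, so the number of cells does not
enter. Topological supports are used because they contain the supports of all derivatives. -/
theorem norm_iteratedFDeriv_sum_le {I E : Type*} [Fintype I] [NormedAddCommGroup E]
    [NormedSpace ℝ E] {f : I → E → ℝ} {k : ℕ} (hf : ∀ j, ContDiff ℝ k (f j))
    (hdisj : ∀ x i j, x ∈ tsupport (f i) → x ∈ tsupport (f j) → i = j) {M : ℝ} (hM : 0 ≤ M)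
    (hb : ∀ j x, ‖iteratedFDeriv ℝ k (f j) x‖ ≤ M) (x : E) :
    ‖iteratedFDeriv ℝ k (fun z => ∑ j, f j z) x‖ ≤ M := by
  have e : iteratedFDeriv ℝ k (fun z => ∑ j, f j z) x = ∑ j, iteratedFDeriv ℝ k (f j) x := by
    rw [← iteratedFDeriv_sum_apply fun j _ => (hf j).contDiffAt]
    congr 1
    ext z; simp
  rw [e]
  by_cases hx : ∃ i, x ∈ tsupport (f i)
  · obtain ⟨i, hi⟩ := hx
    rw [Finset.sum_eq_single i (fun j _ hj => ?_) (by simp)]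
    · exact hb i x
    · by_contra h
      exact hj (hdisj x j i (support_iteratedFDeriv_subset k h) hi)
  · rw [Finset.sum_eq_zero fun j _ => ?_]
    · simpa using hM
    · by_contra h
      exact hx ⟨j, support_iteratedFDeriv_subset k h⟩

/-! ### The unit cube and its uniform law -/

theorem unitCube_eq_preimage (d : ℕ) :
    unitCube d = (WithLp.ofLp : EuclideanSpace ℝ (Fin d) → Fin d → ℝ) ⁻¹' Set.Icc 0 1 := by
  ext z
  simp [unitCube, Pi.le_def, forall_and]

theorem isCompact_unitCube (d : ℕ) : IsCompact (unitCube d) := by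
  rw [unitCube_eq_preimage]
  exact (EuclideanSpace.equiv (Fin d) ℝ).toHomeomorph.isCompact_preimage.2 isCompact_Icc

theorem convex_unitCube (d : ℕ) : Convex ℝ (unitCube d) := by
  rw [unitCube_eq_preimage]
  exact (convex_Icc 0 1).linear_preimage (EuclideanSpace.equiv (Fin d) ℝ).toLinearMap

theorem measurableSet_unitCube (d : ℕ) : MeasurableSet (unitCube d) :=
  (isCompact_unitCube d).measurableSet

instance isProbabilityMeasure_uniformCube (d : ℕ) : IsProbabilityMeasure (uniformCube d) := by
  constructor
  rw [uniformCube, Measure.restrict_apply_univ, unitCube_eq_preimage]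
  rw [(PiLp.volume_preserving_ofLp (Fin d)).measure_preimage
    measurableSet_Icc.nullMeasurableSet, Real.volume_Icc_pi]
  simp

/-! ### Change of variables for a shift in one direction -/

section Perturbation

variable {d : ℕ} {F : EuclideanSpace ℝ (Fin d) → ℝ} {v : EuclideanSpace ℝ (Fin d)}

theorem hasFDerivAt_add_smul (hF : ContDiff ℝ 1 F) (z) :
    HasFDerivAt (fun z => z + F z • v)
      (ContinuousLinearMap.id ℝ _ + (fderiv ℝ F z).smulRight v) z :=
  (hasFDerivAt_id z).add (((hF.differentiable one_ne_zero) z).hasFDerivAt.smul_const v)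

/-- `F` is `1/2`-Lipschitz, so the map is a strict contraction away from the identity; this yields
injectivity and surjectivity at once. -/
theorem approximatesLinearOn_add_smul (hF : ContDiff ℝ 1 F) (hv : ‖v‖ = 1)
    (hF' : ∀ z, ‖fderiv ℝ F z‖ ≤ 1 / 2) :
    ApproximatesLinearOn (fun z => z + F z • v)
      ((ContinuousLinearEquiv.refl ℝ (EuclideanSpace ℝ (Fin d)) :
        EuclideanSpace ℝ (Fin d) →L[ℝ] EuclideanSpace ℝ (Fin d))) Set.univ (1 / 2) := by
  intro x _ y _
  have h : ‖F x - F y‖ ≤ 1 / 2 * ‖x - y‖ :=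
    convex_univ.norm_image_sub_le_of_norm_fderiv_le (𝕜 := ℝ)
      (fun z _ => (hF.differentiable one_ne_zero) z) (fun z _ => hF' z) trivial trivial
  have e : x + F x • v - (y + F y • v) - (x - y) = (F x - F y) • v := by
    rw [sub_smul]; abel
  simp only [ContinuousLinearEquiv.coe_refl, ContinuousLinearMap.id_apply]
  rw [e, norm_smul, hv, mul_one]
  simpa using h

/-- Change of variables for a perturbation of the identity in one fixed direction. -/
theorem map_withDensity_add_smul (hF : ContDiff ℝ 1 F) (hv : ‖v‖ = 1)
    (hF' : ∀ z, ‖fderiv ℝ F z‖ ≤ 1 / 2) {A : Set (EuclideanSpace ℝ (Fin d))}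
    (hA : MeasurableSet A) (hinv : ∀ z, z + F z • v ∈ A ↔ z ∈ A) :
    ((volume.restrict A).withDensity fun z => ENNReal.ofReal (1 + fderiv ℝ F z v)).map
      (fun z => z + F z • v) = volume.restrict A := by
  have hap := approximatesLinearOn_add_smul hF hv hF'
  have hc : Subsingleton (EuclideanSpace ℝ (Fin d)) ∨ (1 / 2 : NNReal) <
      ‖((ContinuousLinearEquiv.refl ℝ (EuclideanSpace ℝ (Fin d))).symm :
        EuclideanSpace ℝ (Fin d) →L[ℝ] EuclideanSpace ℝ (Fin d))‖₊⁻¹ := by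
    right
    have : Nontrivial (EuclideanSpace ℝ (Fin d)) :=
      ⟨v, 0, fun h => by rw [h, norm_zero] at hv; exact zero_ne_one hv⟩
    rw [ContinuousLinearEquiv.refl_symm, ContinuousLinearEquiv.coe_refl]
    rw [← NNReal.coe_lt_coe]
    simp only [NNReal.coe_div, NNReal.coe_one, NNReal.coe_ofNat, NNReal.coe_inv, coe_nnnorm,
      ContinuousLinearMap.norm_id]
    norm_num
  have hinj := hap.injOn hc
  have hsurj := hap.surjective hc
  have himg : (fun z => z + F z • v) '' A = A := by
    ext y
    constructor
    · rintro ⟨z, hz, rfl⟩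
      exact (hinv z).2 hz
    · intro hy
      obtain ⟨z, rfl⟩ := hsurj y
      exact ⟨z, (hinv z).1 hy, rfl⟩
  have key := map_withDensity_abs_det_fderiv_eq_addHaar volume hA.nullMeasurableSet
    (fun z _ => (hasFDerivAt_add_smul hF z).hasFDerivWithinAt)
    (hinj.mono (Set.subset_univ A))
  rw [himg] at key
  rw [← key]
  congr 2
  ext z
  -- The derivative is a rank-one perturbation of the identity, so its determinant is affine in `F`.
  have hdet : (ContinuousLinearMap.id ℝ _ + (fderiv ℝ F z).smulRight v).det =
      1 + fderiv ℝ F z v := by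
    have := LinearMap.transvection.det
      (fderiv ℝ F z : EuclideanSpace ℝ (Fin d) →ₗ[ℝ] ℝ) v
    rw [ContinuousLinearMap.coe_coe] at this
    rw [← this, ContinuousLinearMap.det]
    rfl
  have hpos : 0 ≤ 1 + fderiv ℝ F z v := by
    have := (fderiv ℝ F z).le_opNorm v
    rw [hv, mul_one, Real.norm_eq_abs] at this
    have := (abs_le.1 (this.trans (hF' z))).1
    linarith
  rw [hdet, abs_of_nonneg hpos]

end Perturbation

/-! ### Integrals and gradients of the bumps -/

/-- Rescaling of integrals of functions supported in a small ball of the cube. -/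
theorem integral_uniformCube_rescale {d : ℕ} {h : ℝ} (hh : 0 < h) {c : EuclideanSpace ℝ (Fin d)}
    (hc : Metric.ball c (h / 2) ⊆ unitCube d) {G : EuclideanSpace ℝ (Fin d) → ℝ}
    (hG : ∀ u, 1 / 2 ≤ ‖u‖ → G u = 0) :
    ∫ z, G (h⁻¹ • (z - c)) ∂(uniformCube d) = h ^ d * ∫ u, G u := by
  rw [uniformCube, setIntegral_eq_integral_of_forall_compl_eq_zero]
  · rw [integral_sub_right_eq_self (fun z => G (h⁻¹ • z)) c, Measure.integral_comp_inv_smul]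
    simp [abs_of_nonneg hh.le]
  · intro z hz
    refine hG _ ?_
    rw [norm_smul, norm_inv, Real.norm_of_nonneg hh.le, ← dist_eq_norm,
      inv_mul_eq_div, le_div_iff₀ hh]
    by_contra hlt
    exact hz (hc (Metric.mem_ball.2 (by linarith)))

theorem unitBump_eq_zero {d : ℕ} {u : EuclideanSpace ℝ (Fin d)} (hu : 1 / 16 ≤ ‖u‖) :
    unitBump d u = 0 :=
  (unitBump d).zero_of_le_dist (by rwa [dist_zero_right])

theorem integral_cellBump {d : ℕ} {a h : ℝ} (hh : 0 < h) {c : EuclideanSpace ℝ (Fin d)}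
    (hc : Metric.ball c (h / 2) ⊆ unitCube d) :
    ∫ z, cellBump a h c z ∂(uniformCube d) = a * h * (h ^ d * ∫ u, unitBump d u) := by
  simp only [cellBump]
  rw [integral_const_mul, integral_uniformCube_rescale (G := unitBump d) hh hc fun u hu =>
    unitBump_eq_zero (by linarith)]

theorem fderiv_cellBump {d : ℕ} {a h : ℝ} (hh : 0 < h) (c z : EuclideanSpace ℝ (Fin d)) :
    fderiv ℝ (cellBump a h c) z = a • fderiv ℝ (unitBump d) (h⁻¹ • (z - c)) := by
  have h1 : HasFDerivAt (fun z => h⁻¹ • (z - c))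
      (h⁻¹ • ContinuousLinearMap.id ℝ (EuclideanSpace ℝ (Fin d))) z :=
    ((hasFDerivAt_id z).sub_const c).const_smul h⁻¹
  have h2 : HasFDerivAt (unitBump d) (fderiv ℝ (unitBump d) (h⁻¹ • (z - c))) (h⁻¹ • (z - c)) :=
    (((unitBump d).contDiff (n := 1)).differentiable one_ne_zero _).hasFDerivAt
  have h3 := (h2.comp z h1).const_mul (a * h)
  refine h3.fderiv.trans ?_
  ext w
  simp
  field_simp

/-- Height `a h` over width `h` gives a gradient of size `a` at every scale, so `h` enters only
through the volume of the cell. This is the χ² cost of one bump. -/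
theorem integral_sq_fderiv_cellBump {d : ℕ} {a h : ℝ} (hh : 0 < h) {c : EuclideanSpace ℝ (Fin d)}
    (hc : Metric.ball c (h / 2) ⊆ unitCube d) (v : EuclideanSpace ℝ (Fin d)) :
    ∫ z, (fderiv ℝ (cellBump a h c) z v) ^ 2 ∂(uniformCube d) =
      a ^ 2 * (h ^ d * ∫ u, (fderiv ℝ (unitBump d) u v) ^ 2) := by
  have e : ∀ z, (fderiv ℝ (cellBump a h c) z v) ^ 2 =
      a ^ 2 * (fun u => (fderiv ℝ (unitBump d) u v) ^ 2) (h⁻¹ • (z - c)) := fun z => by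
    rw [fderiv_cellBump hh]
    simp only [smul_apply, smul_eq_mul]
    ring
  simp_rw [e]
  rw [integral_const_mul, integral_uniformCube_rescale
    (G := fun u => (fderiv ℝ (unitBump d) u v) ^ 2) hh hc fun u hu => ?_]
  have : fderiv ℝ (unitBump d) u = 0 := by
    by_contra hne
    have hs := support_fderiv_subset ℝ hne
    rw [(unitBump d).tsupport_eq, mem_closedBall_zero_iff] at hs
    have : ‖u‖ ≤ 1 / 16 := hs
    linarith
  simp [this]

theorem norm_fderiv_cellBump_le {d : ℕ} {a h B : ℝ} (ha : 0 ≤ a) (hh : 0 < h)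
    (hB : ∀ x, ‖iteratedFDeriv ℝ 1 (unitBump d) x‖ ≤ B) (c z : EuclideanSpace ℝ (Fin d)) :
    ‖fderiv ℝ (cellBump a h c) z‖ ≤ a * B := by
  rw [fderiv_cellBump hh, norm_smul, Real.norm_of_nonneg ha, ← norm_iteratedFDeriv_one]
  gcongr
  exact hB _

/-! ### The grid, the perturbed identities and the test functions -/

theorem EuclideanSpace.abs_apply_sub_le_dist {d : ℕ} (x y : EuclideanSpace ℝ (Fin d)) (i : Fin d) :
    |x i - y i| ≤ dist x y := by
  rw [dist_eq_norm]
  exact PiLp.norm_apply_le (x - y) i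

/-- The centres of the cells of the regular grid with `m ^ d` cells in the unit cube. -/
def gridCentre {d m : ℕ} (j : Fin d → Fin m) : EuclideanSpace ℝ (Fin d) :=
  WithLp.toLp 2 fun i => ((j i : ℝ) + 1 / 2) * (m : ℝ)⁻¹

theorem le_dist_gridCentre {d m : ℕ} {j k : Fin d → Fin m} (hjk : j ≠ k) :
    (m : ℝ)⁻¹ ≤ dist (gridCentre j) (gridCentre k) := by
  obtain ⟨i, hi⟩ := Function.ne_iff.1 hjk
  refine le_trans ?_ (EuclideanSpace.abs_apply_sub_le_dist _ _ i)
  simp only [gridCentre]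
  rw [← sub_mul, abs_mul, abs_of_nonneg (by positivity : (0 : ℝ) ≤ (m : ℝ)⁻¹)]
  refine le_mul_of_one_le_left (by positivity) ?_
  have h1 : ((j i : ℕ) : ℤ) - (k i : ℕ) ≠ 0 := by
    have := Fin.val_ne_of_ne hi
    omega
  have h2 : (1 : ℝ) ≤ |(((j i : ℕ) : ℤ) - (k i : ℕ) : ℤ)| := by exact_mod_cast Int.one_le_abs h1
  push_cast at h2
  rwa [add_sub_add_right_eq_sub]

theorem ball_gridCentre_subset {d m : ℕ} (j : Fin d → Fin m) :
    Metric.ball (gridCentre j) ((m : ℝ)⁻¹ / 2) ⊆ unitCube d := by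
  intro z hz i
  have hm : 0 < m := (Nat.zero_le _).trans_lt (j i).2
  have hm' : (0 : ℝ) < m := by exact_mod_cast hm
  have h1 := (EuclideanSpace.abs_apply_sub_le_dist z (gridCentre j) i).trans_lt
    (Metric.mem_ball.1 hz)
  have hj : ((j i : ℕ) : ℝ) + 1 ≤ m := by exact_mod_cast (j i).2
  have hj0 : (0 : ℝ) ≤ (j i : ℕ) := Nat.cast_nonneg _
  have hinv : (0 : ℝ) < (m : ℝ)⁻¹ := by positivity
  simp only [gridCentre] at h1
  rw [abs_lt] at h1
  have h2 : (((j i : ℕ) : ℝ) + 1) * (m : ℝ)⁻¹ ≤ 1 := by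
    rw [← div_eq_mul_inv, div_le_one hm']; exact hj
  have h3 : 0 ≤ ((j i : ℕ) : ℝ) * (m : ℝ)⁻¹ := by positivity
  constructor <;> nlinarith

/-- A sum of bumps on the cells selected by `ε`. -/
def bumpSum {d : ℕ} {I : Type*} [Fintype I] (a h : ℝ) (c : I → EuclideanSpace ℝ (Fin d))
    (ε : I → Bool) (z : EuclideanSpace ℝ (Fin d)) : ℝ :=
  ∑ j, if ε j then cellBump a h (c j) z else 0

/-- The perturbation of the identity in the coordinate direction `i₀` by `bumpSum`. -/
def perturb {d : ℕ} {I : Type*} [Fintype I] (i₀ : Fin d) (a h : ℝ)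
    (c : I → EuclideanSpace ℝ (Fin d)) (ε : I → Bool) (z : EuclideanSpace ℝ (Fin d)) :
    EuclideanSpace ℝ (Fin d) :=
  z + bumpSum a h c ε z • EuclideanSpace.single i₀ (1 : ℝ)

/-- A `1`-Lipschitz function supported in a cell and increasing with slope `1` in the direction `i₀`
near the centre of the cell. -/
def cellTest {d : ℕ} (i₀ : Fin d) (h : ℝ) (c z : EuclideanSpace ℝ (Fin d)) : ℝ :=
  max 0 (min (z i₀ - c i₀ + h / 8) (h / 2 - dist z c))

theorem eq_of_dist_lt {X I : Type*} [PseudoMetricSpace X] {c : I → X} {h : ℝ}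
    (hsep : ∀ i j, i ≠ j → h ≤ dist (c i) (c j))
    {z : X} {i j : I} (hi : dist z (c i) < h / 2)
    (hj : dist z (c j) ≤ h / 2) : i = j := by
  by_contra hne
  have := hsep i j hne
  have h3 := dist_triangle_left (c i) (c j) z
  linarith

theorem add_cellBump_smul_mem_iff {d : ℕ} {i₀ : Fin d} {a h : ℝ}
    {c : EuclideanSpace ℝ (Fin d)} (hh : 0 < h)
    (ha : 0 ≤ a) (ha' : a ≤ 1 / 16)
    (hc : Metric.ball c (h / 2) ⊆ unitCube d) (z : EuclideanSpace ℝ (Fin d)) :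
    z + cellBump a h c z • EuclideanSpace.single i₀ (1 : ℝ) ∈ unitCube d ↔ z ∈ unitCube d := by
  have hah : a * h ≤ h / 16 := by nlinarith
  by_cases hz : dist z c < h / 16
  · refine iff_of_true (hc ?_) (hc ?_)
    · have h1 : dist (z + cellBump a h c z • EuclideanSpace.single i₀ (1 : ℝ)) z ≤ a * h := by
        rw [dist_eq_norm, add_sub_cancel_left, norm_smul, PiLp.norm_single, norm_one,
          mul_one, Real.norm_of_nonneg (cellBump_nonneg _ ha hh.le z)]
        exact cellBump_le _ ha hh.le z
      have := dist_triangle (z + cellBump a h c z • EuclideanSpace.single i₀ (1 : ℝ)) z c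
      exact Metric.mem_ball.2 (by linarith)
    · exact Metric.mem_ball.2 (by linarith)
  · rw [cellBump_eq_zero _ hh (not_lt.1 hz), zero_smul, add_zero]

section Cells

variable {d : ℕ} {I : Type*} [Fintype I] {i₀ : Fin d} {a h : ℝ}
  {c : I → EuclideanSpace ℝ (Fin d)}

theorem contDiff_bumpSum (ε : I → Bool) (n : ℕ∞) : ContDiff ℝ n (bumpSum a h c ε) := by
  refine ContDiff.sum fun j _ => ?_
  by_cases hj : ε j = true
  · simpa [hj] using contDiff_cellBump (c j) n
  · simpa [hj] using contDiff_const

theorem continuous_perturb (ε : I → Bool) : Continuous (perturb i₀ a h c ε) := by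
  have := (contDiff_bumpSum (a := a) (h := h) (c := c) ε 0).continuous
  unfold perturb
  fun_prop

theorem cellTest_nonneg (c z : EuclideanSpace ℝ (Fin d)) : 0 ≤ cellTest i₀ h c z := le_max_left _ _

theorem cellTest_le (hh : 0 ≤ h) (c z : EuclideanSpace ℝ (Fin d)) : cellTest i₀ h c z ≤ h :=
  max_le hh ((min_le_right _ _).trans (by linarith [dist_nonneg (x := z) (y := c)]))

theorem cellTest_eq_zero {c z : EuclideanSpace ℝ (Fin d)} (hz : h / 2 ≤ dist z c) :
    cellTest i₀ h c z = 0 :=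
  max_eq_left ((min_le_right _ _).trans (by linarith))

/-- Within `h / 8` of the centre the affine branch lies in `[0, h / 4]`, while the cutoff branch is
at least `3 h / 8`. -/
theorem cellTest_of_dist_le {c z : EuclideanSpace ℝ (Fin d)} (hz : dist z c ≤ h / 8) :
    cellTest i₀ h c z = z i₀ - c i₀ + h / 8 := by
  have h1 := abs_le.1 ((EuclideanSpace.abs_apply_sub_le_dist z c i₀).trans hz)
  have h0 : 0 ≤ dist z c := dist_nonneg
  rw [cellTest, min_eq_left (by linarith), max_eq_right (by linarith)]

theorem lipschitzWith_cellTest (c : EuclideanSpace ℝ (Fin d)) :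
    LipschitzWith 1 (cellTest i₀ h c) := by
  have h1 : LipschitzWith 1 fun z : EuclideanSpace ℝ (Fin d) => z i₀ - c i₀ + h / 8 :=
    LipschitzWith.of_dist_le_mul fun x y => by
      have := EuclideanSpace.abs_apply_sub_le_dist x y i₀
      rw [Real.dist_eq, NNReal.coe_one, one_mul]
      convert this using 2
      ring
  have h2 : LipschitzWith 1 fun z : EuclideanSpace ℝ (Fin d) => h / 2 - dist z c :=
    LipschitzWith.of_dist_le_mul fun x y => by
      rw [Real.dist_eq, NNReal.coe_one, one_mul]
      have e : h / 2 - dist x c - (h / 2 - dist y c) = dist y c - dist x c := by ring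
      rw [e, abs_sub_comm]
      exact abs_dist_sub_le x y c
  have h3 := (h1.min h2).const_max 0
  rw [max_self] at h3
  exact h3

theorem bumpSum_of_dist_lt (hh : 0 < h)
    (hsep : ∀ i j, i ≠ j → h ≤ dist (c i) (c j))
    (ε : I → Bool) {z : EuclideanSpace ℝ (Fin d)} {j : I}
    (hz : dist z (c j) < h / 2) :
    bumpSum a h c ε z = if ε j then cellBump a h (c j) z else 0 := by
  refine Finset.sum_eq_single j (fun k _ hk => ?_) (by simp)
  have : cellBump a h (c k) z = 0 := by
    refine cellBump_eq_zero _ hh ?_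
    by_contra hlt
    exact hk (eq_of_dist_lt hsep hz (by linarith)).symm
  simp [this]

theorem bumpSum_eq_zero_or (hh : 0 < h)
    (ε : I → Bool) (z : EuclideanSpace ℝ (Fin d)) :
    bumpSum a h c ε z = 0 ∨ ∃ k, dist z (c k) < h / 16 := by
  by_cases hk : ∃ k, dist z (c k) < h / 16
  · exact .inr hk
  · push Not at hk
    refine .inl (Finset.sum_eq_zero fun j _ => ?_)
    simp [cellBump_eq_zero (c j) hh (hk j)]

theorem abs_bumpSum_le (hh : 0 < h)
    (hsep : ∀ i j, i ≠ j → h ≤ dist (c i) (c j))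
    (ha : 0 ≤ a) (ε : I → Bool) (z : EuclideanSpace ℝ (Fin d)) :
    |bumpSum a h c ε z| ≤ a * h := by
  have hah : 0 ≤ a * h := by positivity
  rcases bumpSum_eq_zero_or (a := a) hh ε z with h0 | ⟨k, hk⟩
  · rw [h0, abs_zero]; exact hah
  · rw [bumpSum_of_dist_lt hh hsep ε (j := k) (by linarith)]
    split_ifs
    · rw [abs_of_nonneg (cellBump_nonneg _ ha hh.le z)]
      exact cellBump_le _ ha hh.le z
    · rw [abs_zero]; exact hah

theorem dist_perturb_le (hh : 0 < h)
    (hsep : ∀ i j, i ≠ j → h ≤ dist (c i) (c j))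
    (ha : 0 ≤ a) (ε : I → Bool) (z : EuclideanSpace ℝ (Fin d)) :
    dist (perturb i₀ a h c ε z) z ≤ a * h := by
  rw [dist_eq_norm, perturb, add_sub_cancel_left, norm_smul, PiLp.norm_single, norm_one,
    mul_one]
  exact abs_bumpSum_le hh hsep ha ε z

/-- Points that move stay within `h / 8` of their centre. In cell `j` the test function is affine
with slope 1 there and records the displacement exactly; in another cell it vanishes before and
after. Thus its integral depends on `ε` only through `ε j`. -/
theorem cellTest_perturb (hh : 0 < h)
    (hsep : ∀ i j, i ≠ j → h ≤ dist (c i) (c j))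
    (ha : 0 ≤ a) (ha' : a ≤ 1 / 16) (ε : I → Bool) (j : I)
    (z : EuclideanSpace ℝ (Fin d)) :
    cellTest i₀ h (c j) (perturb i₀ a h c ε z) =
      cellTest i₀ h (c j) z + if ε j then cellBump a h (c j) z else 0 := by
  have hd := dist_perturb_le (i₀ := i₀) hh hsep ha ε z
  have hah : a * h ≤ h / 16 := by nlinarith
  rcases bumpSum_eq_zero_or (a := a) hh ε z with h0 | ⟨k, hk⟩
  · have hz : (if ε j then cellBump a h (c j) z else 0) = 0 := by
      by_cases hj : dist z (c j) < h / 2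
      · rwa [← bumpSum_of_dist_lt hh hsep ε hj]
      · simp [cellBump_eq_zero (a := a) (c j) hh (z := z) (by linarith)]
    rw [hz, perturb, h0]
    simp
  · have htri := dist_triangle (perturb i₀ a h c ε z) z (c k)
    rcases eq_or_ne k j with rfl | hkj
    · rw [cellTest_of_dist_le (by linarith), cellTest_of_dist_le (by linarith),
        ← bumpSum_of_dist_lt hh hsep ε (by linarith), perturb]
      simp
      ring
    · have far : ∀ w, dist w (c k) ≤ h / 8 → h / 2 ≤ dist w (c j) := fun w hw => by
        by_contra hlt
        exact hkj (eq_of_dist_lt hsep (z := w) (by linarith) (by linarith))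
      have hf := far z (by linarith)
      rw [cellTest_eq_zero (far _ (by linarith)), cellTest_eq_zero hf,
        cellBump_eq_zero _ hh (by linarith)]
      simp

/-- Switching on a bump amounts to first moving the points of its cell. -/
theorem perturb_update [DecidableEq I] (hh : 0 < h)
    (hsep : ∀ i j, i ≠ j → h ≤ dist (c i) (c j))
    (ha : 0 ≤ a) (ha' : a ≤ 1 / 16) {ε : I → Bool} {j : I}
    (hj : ε j = false) (z : EuclideanSpace ℝ (Fin d)) :
    perturb i₀ a h c ε (z + cellBump a h (c j) z • EuclideanSpace.single i₀ (1 : ℝ)) =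
      perturb i₀ a h c (Function.update ε j true) z := by
  have hah : a * h ≤ h / 16 := by nlinarith
  by_cases hz : dist z (c j) < h / 16
  · have h1 : bumpSum a h c (Function.update ε j true) z = cellBump a h (c j) z := by
      rw [bumpSum_of_dist_lt hh hsep _ (j := j) (by linarith)]
      simp
    have hd : dist (perturb i₀ a h c (Function.update ε j true) z) (c j) < h / 2 := by
      have := dist_triangle (perturb i₀ a h c (Function.update ε j true) z) z (c j)
      have := dist_perturb_le (i₀ := i₀) hh hsep ha (Function.update ε j true) z
      linarith
    -- The moved point is still in cell `j`, where `ε` is switched off, so the second map leaves it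
    -- fixed.
    have h2 : bumpSum a h c ε (perturb i₀ a h c (Function.update ε j true) z) = 0 := by
      rw [bumpSum_of_dist_lt hh hsep _ hd, hj]
      simp
    rw [← h1]
    change perturb i₀ a h c ε (perturb i₀ a h c (Function.update ε j true) z) = _
    conv_lhs => rw [perturb, h2]
    simp
  · have h0 : cellBump a h (c j) z = 0 := cellBump_eq_zero _ hh (not_lt.1 hz)
    have h1 : bumpSum a h c (Function.update ε j true) z = bumpSum a h c ε z := by
      refine Finset.sum_congr rfl fun k _ => ?_
      rcases eq_or_ne k j with rfl | hk
      · simp [h0]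
      · rw [Function.update_of_ne hk]
    rw [h0, zero_smul, add_zero, perturb, perturb, h1]

theorem holderBoundOn_bumpSum (hh : 0 < h)
    (hsep : ∀ i j, i ≠ j → h ≤ dist (c i) (c j))
    {s : ℕ} {α : ℝ} (hα0 : 0 < α) (hα1 : α ≤ 1) (ha : 0 ≤ a)
    (hh1 : h ≤ 1) {B : ℝ} (hB0 : 0 ≤ B)
    (hB : ∀ j ≤ s + 1, ∀ x, ‖iteratedFDeriv ℝ j (unitBump d) x‖ ≤ B) (ε : I → Bool)
    {A : Set (EuclideanSpace ℝ (Fin d))} (hA : Convex ℝ A) :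
    HolderBoundOn s α A (2 * (a * h * B * h ^ (-(s + α)))) (bumpSum a h c ε) := by
  refine HolderBoundOn.of_derivative_bounds hA hα0 hα1 hh hh1 (by positivity)
    (contDiff_bumpSum ε ((s + 1 : ℕ) : ℕ∞)) fun j hj x _ => ?_
  refine norm_iteratedFDeriv_sum_le (f := fun k z => if ε k then cellBump a h (c k) z else 0)
    (fun k => ?_) (fun z k l hk hl => ?_) (by positivity) (fun k z => ?_) x
  · by_cases hk : ε k = true
    · simpa [hk] using contDiff_cellBump (c k) j
    · simpa [hk] using contDiff_const
  · have hsub : ∀ k, z ∈ tsupport (fun z => if ε k then cellBump a h (c k) z else 0) →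
        dist z (c k) ≤ h / 16 := by
      intro k hk
      by_cases hεk : ε k = true
      · simp only [hεk, if_true] at hk
        exact Metric.mem_closedBall.1 (tsupport_cellBump_subset (c k) hh hk)
      · simp [hεk, tsupport] at hk
    have h1 := hsub k hk
    have h2 := hsub l hl
    exact eq_of_dist_lt hsep (z := z) (by linarith) (by linarith)
  · by_cases hk : ε k = true
    · simp only [hk, if_true]
      exact norm_iteratedFDeriv_cellBump_le (c k) ha hh (hB j hj) z
    · simp only [hk]
      have : iteratedFDeriv ℝ j (fun _ : EuclideanSpace ℝ (Fin d) => (0 : ℝ)) z = 0 := by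
        rw [iteratedFDeriv_fun_zero]; rfl
      simp only [Bool.false_eq_true, if_false, this, norm_zero]
      positivity

end Cells

/-! ### Embedding into dimension `D` -/

/-- Padding a vector by zeros. -/
def padZero {d : ℕ} (D : ℕ) (z : EuclideanSpace ℝ (Fin d)) : EuclideanSpace ℝ (Fin D) :=
  WithLp.toLp 2 fun k => if h : (k : ℕ) < d then z ⟨k, h⟩ else 0

/-- Restriction of a vector to its first coordinates. -/
def truncate {d D : ℕ} (hdD : d ≤ D) (y : EuclideanSpace ℝ (Fin D)) : EuclideanSpace ℝ (Fin d) :=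
  WithLp.toLp 2 fun i => y (Fin.castLE hdD i)

theorem truncate_padZero {d D : ℕ} (hdD : d ≤ D) (z : EuclideanSpace ℝ (Fin d)) :
    truncate hdD (padZero D z) = z := by
  ext i
  simp [truncate, padZero]

theorem continuous_padZero {d : ℕ} (D : ℕ) :
    Continuous (padZero D : EuclideanSpace ℝ (Fin d) → EuclideanSpace ℝ (Fin D)) := by
  refine (PiLp.continuous_toLp 2 _).comp (continuous_pi fun k => ?_)
  by_cases h : (k : ℕ) < d
  · simp only [h, dif_pos]; fun_prop
  · simp only [h, dif_neg, not_false_eq_true]; fun_prop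

theorem lipschitzWith_truncate {d D : ℕ} (hdD : d ≤ D) : LipschitzWith 1 (truncate hdD) := by
  refine LipschitzWith.of_dist_le_mul fun x y => ?_
  rw [NNReal.coe_one, one_mul, EuclideanSpace.dist_eq, EuclideanSpace.dist_eq]
  refine Real.sqrt_le_sqrt ?_
  have := Finset.sum_le_univ_sum_of_nonneg (f := fun k => dist (x k) (y k) ^ 2)
    (s := Finset.univ.map (Fin.castLEEmb hdD)) fun k => sq_nonneg _
  rw [Finset.sum_map] at this
  exact this

/-! ### The minimax bound for a family of cells -/

section Hypercube

variable {d D : ℕ} {I : Type*} [Fintype I] {i₀ : Fin d} {a h : ℝ}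
  {c : I → EuclideanSpace ℝ (Fin d)}

theorem continuous_padZero_perturb (ε : I → Bool) :
    Continuous fun z => padZero D (perturb i₀ a h c ε z) :=
  (continuous_padZero D).comp (continuous_perturb ε)

theorem isProbabilityMeasure_generatedLaw_perturb (ε : I → Bool) :
    IsProbabilityMeasure (generatedLaw fun z => padZero D (perturb i₀ a h c ε z)) :=
  Measure.isProbabilityMeasure_map (continuous_padZero_perturb ε).measurable.aemeasurable

/-- The laws of samples from two generators that differ in one bump share half of their mass. -/
theorem exists_common_le_dataLaw [DecidableEq I] (hh : 0 < h)
    (hsep : ∀ i j, i ≠ j → h ≤ dist (c i) (c j))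
    (hcube : ∀ j, Metric.ball (c j) (h / 2) ⊆ unitCube d) (ha : 0 ≤ a) (ha' : a ≤ 1 / 16)
    {B : ℝ} (hB : ∀ x, ‖iteratedFDeriv ℝ 1 (unitBump d) x‖ ≤ B) (haB : a * B ≤ 1 / 2) {n : ℕ}
    (hn : n * (a ^ 2 * (h ^ d * ∫ u, (fderiv ℝ (unitBump d) u (EuclideanSpace.single i₀ 1)) ^ 2)) ≤
      1 / 5) (σ : ℝ) (ε : I → Bool) (j : I) (hj : ε j = false) :
    ∃ R : Measure (Fin n → EuclideanSpace ℝ (Fin D)),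
      R ≤ Measure.pi (fun _ => dataLaw (fun z => padZero D (perturb i₀ a h c ε z)) σ) ∧
      R ≤ Measure.pi (fun _ => dataLaw
        (fun z => padZero D (perturb i₀ a h c (Function.update ε j true) z)) σ) ∧
      1 / 2 ≤ R Set.univ := by
  set v : EuclideanSpace ℝ (Fin d) := EuclideanSpace.single i₀ 1 with hvdef
  have hv : ‖v‖ = 1 := by simp [hvdef]
  set F := cellBump a h (c j) with hF
  have hFs : ContDiff ℝ 1 F := contDiff_cellBump (c j) 1
  have hF' : ∀ z, ‖fderiv ℝ F z‖ ≤ 1 / 2 := fun z =>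
    (norm_fderiv_cellBump_le ha hh hB (c j) z).trans haB
  have hFv : ∀ z, |fderiv ℝ F z v| ≤ 1 / 2 := fun z => by
    have := (fderiv ℝ F z).le_opNorm v
    rw [hv, mul_one, Real.norm_eq_abs] at this
    exact this.trans (hF' z)
  have hJm : Measurable fun z => 1 + fderiv ℝ F z v :=
    measurable_const.add
      ((hFs.continuous_fderiv one_ne_zero).clm_apply continuous_const).measurable
  have hJ0 : ∀ z, 0 ≤ 1 + fderiv ℝ F z v := fun z => by linarith [(abs_le.1 (hFv z)).1]
  have hJ2 : ∀ z, 1 + fderiv ℝ F z v ≤ 2 := fun z => by linarith [(abs_le.1 (hFv z)).2]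
  have hmap : ((uniformCube d).withDensity fun z => ENNReal.ofReal (1 + fderiv ℝ F z v)).map
      (fun z => z + F z • v) = uniformCube d :=
    map_withDensity_add_smul hFs hv hF' (measurableSet_unitCube d)
      (add_cellBump_smul_mem_iff hh ha ha' (hcube j))
  have hτ : Continuous fun z => z + F z • v := by
    have := hFs.continuous
    fun_prop
  have hint : Integrable (fun z => 1 + fderiv ℝ F z v) (uniformCube d) :=
    Integrable.of_bound hJm.aestronglyMeasurable 2
      (.of_forall fun z => by rw [Real.norm_eq_abs, abs_of_nonneg (hJ0 z)]; exact hJ2 z)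
  -- The tilted measure has mass one because its image is the uniform law; no integration by parts
  -- is needed.
  have h1 : ∫ z, (1 + fderiv ℝ F z v) ∂(uniformCube d) = 1 := by
    have hu : (((uniformCube d).withDensity fun z => ENNReal.ofReal (1 + fderiv ℝ F z v)).map
        (fun z => z + F z • v)) Set.univ = 1 := by rw [hmap]; exact measure_univ
    rw [Measure.map_apply hτ.measurable MeasurableSet.univ, Set.preimage_univ,
      withDensity_apply _ MeasurableSet.univ, Measure.restrict_univ,
      ← ofReal_integral_eq_lintegral_ofReal hint (.of_forall hJ0)] at hu
    exact ENNReal.ofReal_eq_one.1 hu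
  have hg : ∀ ε : I → Bool, Measurable fun z => padZero D (perturb i₀ a h c ε z) := fun ε =>
    (continuous_padZero_perturb ε).measurable
  -- The law at vertex `ε` becomes the image of the tilted cube under the generator of the updated
  -- vertex. The untilted law thus belongs to the updated vertex, and the two dominations are
  -- exchanged at the end.
  have hlaw : generatedLaw (fun z => padZero D (perturb i₀ a h c ε z)) =
      ((uniformCube d).withDensity fun z => ENNReal.ofReal (1 + fderiv ℝ F z v)).map
        fun z => padZero D (perturb i₀ a h c (Function.update ε j true) z) := by
    rw [generatedLaw]
    conv_lhs => rw [← hmap]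
    rw [Measure.map_map (hg ε) hτ.measurable]
    congr 1
    ext1 z
    simp only [Function.comp_apply]
    rw [perturb_update hh hsep ha ha' hj]
  obtain ⟨R, hR1, hR2, hR3⟩ := exists_common_le_pi_conv (n := n) (uniformCube d)
    (multivariateGaussian 0 (σ ^ 2 • (1 : Matrix (Fin D) (Fin D) ℝ)))
    (hg (Function.update ε j true)) hJm hJ0 hJ2 h1 (δ := _) (by
      simp only [add_sub_cancel_left]
      exact (integral_sq_fderiv_cellBump hh (hcube j) v).le) hn
  refine ⟨R, ?_, hR1, hR3⟩
  simp only [dataLaw, hlaw]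
  exact hR2

theorem integral_cellTest_generatedLaw (hdD : d ≤ D) (hh : 0 < h)
    (hsep : ∀ i j, i ≠ j → h ≤ dist (c i) (c j))
    (hcube : ∀ j, Metric.ball (c j) (h / 2) ⊆ unitCube d) (ha : 0 ≤ a) (ha' : a ≤ 1 / 16)
    (ε : I → Bool) (j : I) :
    ∫ y, cellTest i₀ h (c j) (truncate hdD y)
        ∂(generatedLaw fun z => padZero D (perturb i₀ a h c ε z)) =
      ∫ z, cellTest i₀ h (c j) z ∂(uniformCube d) +
        if ε j then a * h * (h ^ d * ∫ u, unitBump d u) else 0 := by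
  have hL : Continuous fun y => cellTest i₀ h (c j) (truncate hdD y) :=
    (lipschitzWith_cellTest (c j)).continuous.comp (lipschitzWith_truncate hdD).continuous
  rw [generatedLaw, integral_map (continuous_padZero_perturb ε).measurable.aemeasurable
    hL.aestronglyMeasurable]
  simp_rw [truncate_padZero, cellTest_perturb hh hsep ha ha']
  have hi : Integrable (cellTest i₀ h (c j)) (uniformCube d) :=
    Integrable.of_bound (lipschitzWith_cellTest (c j)).continuous.aestronglyMeasurable h
      (.of_forall fun z => by
        rw [Real.norm_of_nonneg (cellTest_nonneg _ _)]; exact cellTest_le hh.le _ _)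
  by_cases hj : ε j = true
  · have hb : Integrable (cellBump a h (c j)) (uniformCube d) :=
      Integrable.of_bound (contDiff_cellBump (c j) 0).continuous.aestronglyMeasurable (a * h)
        (.of_forall fun z => by
          rw [Real.norm_of_nonneg (cellBump_nonneg _ ha hh.le _)]; exact cellBump_le _ ha hh.le _)
    simp only [hj, if_true]
    rw [integral_add hi hb, integral_cellBump hh (hcube j)]
  · simp [hj]

/-- The minimax lower bound obtained from a family of disjoint cells. -/
theorem le_wassersteinMinimaxRisk_of_cells [DecidableEq I] (hdD : d ≤ D) (hh : 0 < h)
    (hsep : ∀ i j, i ≠ j → h ≤ dist (c i) (c j))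
    (hcube : ∀ j, Metric.ball (c j) (h / 2) ⊆ unitCube d) (ha : 0 ≤ a) (ha' : a ≤ 1 / 16)
    {B : ℝ} (hB : ∀ x, ‖iteratedFDeriv ℝ 1 (unitBump d) x‖ ≤ B) (haB : a * B ≤ 1 / 2) {n : ℕ}
    (hn : n * (a ^ 2 * (h ^ d * ∫ u, (fderiv ℝ (unitBump d) u (EuclideanSpace.single i₀ 1)) ^ 2)) ≤
      1 / 5) (σ : ℝ) {G : Set (EuclideanSpace ℝ (Fin d) → EuclideanSpace ℝ (Fin D))}
    (hG : ∀ ε, (fun z => padZero D (perturb i₀ a h c ε z)) ∈ G) :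
    ENNReal.ofReal (Fintype.card I * (a * h * (h ^ d * ∫ u, unitBump d u)) / 8) ≤
      wassersteinMinimaxRisk G σ n := by
  refine le_wassersteinMinimaxRisk (fun ε z => padZero D (perturb i₀ a h c ε z)) hG
    isProbabilityMeasure_generatedLaw_perturb
    (exists_common_le_dataLaw hh hsep hcube ha ha' hB haB hn σ)
    (φ := fun j y => cellTest i₀ h (c j) (truncate hdD y)) (fun j => ?_)
    (fun j y => cellTest_nonneg _ _) (fun j y => cellTest_le hh.le _ _)
    (fun y i j hi hj => ?_)
    (fun j b => ∫ z, cellTest i₀ h (c j) z ∂(uniformCube d) +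
        if b then a * h * (h ^ d * ∫ u, unitBump d u) else 0)
    (integral_cellTest_generatedLaw hdD hh hsep hcube ha ha') _ (fun j => ?_)
  · have := (lipschitzWith_cellTest (i₀ := i₀) (h := h) (c j)).comp (lipschitzWith_truncate hdD)
    rwa [one_mul] at this
  · have near : ∀ k, cellTest i₀ h (c k) (truncate hdD y) ≠ 0 →
        dist (truncate hdD y) (c k) < h / 2 := fun k hk => by
      by_contra hlt
      exact hk (cellTest_eq_zero (not_lt.1 hlt))
    exact eq_of_dist_lt hsep (near i hi) (near j hj).le
  · simp only [if_true, Bool.false_eq_true, if_false, add_zero, add_sub_cancel_left]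
    exact le_abs_self _

end Hypercube

/-! ### Choice of scale and height -/

theorem integral_unitBump_pos (d : ℕ) : 0 < ∫ u, unitBump d u :=
  (unitBump d).integral_pos

/-- Lower bound for the minimax risk from a grid with `m ^ d` cells and bumps of relative
height `a`. -/
theorem exists_le_wassersteinMinimaxRisk (d : ℕ) (hd : 1 ≤ d) {β : ℝ} (hβ : 0 < β) :
    ∃ K₀ a₀ κ : ℝ, 0 < a₀ ∧ 0 < κ ∧ ∀ K, K₀ ≤ K → ∀ D, d ≤ D → ∀ σ : ℝ, ∀ n m : ℕ, 1 ≤ m →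
      ∀ a : ℝ, 0 ≤ a → a ≤ a₀ → a * (m : ℝ) ^ (β - 1) ≤ a₀ →
      n * a ^ 2 ≤ a₀ ^ 2 * (m : ℝ) ^ d →
      ENNReal.ofReal (κ * (a * (m : ℝ)⁻¹)) ≤
        wassersteinMinimaxRisk (generatorClass d D β K) σ n := by
  set s := holderOrder β with hs
  set α := β - s with hα
  have hα0 : 0 < α := sub_pos.2 (holderOrder_lt hβ)
  have hα1 : α ≤ 1 := sub_holderOrder_le_one hβ
  let i₀ : Fin d := ⟨0, hd⟩
  obtain ⟨B, hB1, hB⟩ := exists_bound_iteratedFDeriv_unitBump d (s + 1)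
  have hcoord : ∀ i : Fin d, ∃ b, 0 ≤ b ∧
      HolderBoundOn s α (unitCube d) b fun z => z i := fun i =>
    HolderBoundOn.exists_of_contDiff (convex_unitCube d) (isCompact_unitCube d) hα0 hα1
      (by fun_prop)
  choose b hb0 hb using hcoord
  set V := ∫ u, (fderiv ℝ (unitBump d) u (EuclideanSpace.single i₀ 1)) ^ 2 with hV
  have hV0 : 0 ≤ V := integral_nonneg fun u => sq_nonneg _
  -- The three terms keep points near their centre, bound the gradient by `1 / 2`, and bound the χ²
  -- cost by `1 / 5`; `V + 1` avoids dividing by zero.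
  set a₀ : ℝ := min (1 / 16) (min (1 / (2 * B)) (1 / (5 * (V + 1)))) with ha₀
  have ha₀pos : 0 < a₀ := by positivity
  have ha₀1 : a₀ ≤ 1 / 16 := min_le_left _ _
  have ha₀B : a₀ * B ≤ 1 / 2 := by
    have : a₀ ≤ 1 / (2 * B) := (min_le_right _ _).trans (min_le_left _ _)
    calc a₀ * B ≤ 1 / (2 * B) * B := by gcongr
      _ = 1 / 2 := by field_simp
  have ha₀V : a₀ ^ 2 * V ≤ 1 / 5 := by
    have h1 : a₀ ≤ 1 / (5 * (V + 1)) := (min_le_right _ _).trans (min_le_right _ _)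
    rw [le_div_iff₀ (by positivity)] at h1
    nlinarith [mul_nonneg ha₀pos.le hV0]
  have hbs : 0 ≤ ∑ i, b i := Finset.sum_nonneg fun i _ => hb0 i
  -- A component is at most a coordinate function (bound `b i`) plus a bump sum (bound `2 * B`),
  -- doubled by `mem_holderBall`. Padded components vanish, so nothing depends on `D`.
  refine ⟨2 * (∑ i, b i + 2 * B), a₀, (∫ u, unitBump d u) / 8, ha₀pos,
    div_pos (integral_unitBump_pos d) (by norm_num), fun K hK D hdD σ n m hm a ha haa₀ haβ hna => ?_⟩
  have hm0 : (0 : ℝ) < m := by exact_mod_cast hm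
  have hh : (0 : ℝ) < (m : ℝ)⁻¹ := by positivity
  have hh1 : (m : ℝ)⁻¹ ≤ 1 := inv_le_one_of_one_le₀ (by exact_mod_cast hm)
  have hsum : ∀ ε, HolderBoundOn s α (unitCube d) (2 * B)
      (bumpSum a (m : ℝ)⁻¹ (gridCentre : (Fin d → Fin m) → _) ε) := fun ε => by
    refine (holderBoundOn_bumpSum hh (fun i j hij => le_dist_gridCentre hij) hα0 hα1 ha hh1
      (zero_le_one.trans hB1) hB ε (convex_unitCube d)).mono ?_
    have e : (m : ℝ)⁻¹ * (m : ℝ)⁻¹ ^ (-(s + α)) = (m : ℝ) ^ (β - 1) := by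
      have : (s : ℝ) + α = β := by rw [hα]; ring
      rw [this, Real.inv_rpow hm0.le, Real.rpow_neg hm0.le, inv_inv, Real.rpow_sub_one hm0.ne',
        inv_mul_eq_div]
    have e2 : 2 * (a * (m : ℝ)⁻¹ * B * (m : ℝ)⁻¹ ^ (-(s + α))) =
        2 * (a * (m : ℝ) ^ (β - 1)) * B := by rw [← e]; ring
    rw [e2]
    have : a * (m : ℝ) ^ (β - 1) ≤ 1 := haβ.trans (ha₀1.trans (by norm_num))
    nlinarith
  have hmem : ∀ ε, (fun z => padZero D (perturb i₀ a (m : ℝ)⁻¹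
      (gridCentre : (Fin d → Fin m) → _) ε z)) ∈ generatorClass d D β K := by
    intro ε k
    by_cases hk : (k : ℕ) < d
    · have hbk : b ⟨k, hk⟩ ≤ ∑ i, b i :=
        Finset.single_le_sum (f := b) (fun i _ => hb0 i) (Finset.mem_univ _)
      by_cases hki : (⟨k, hk⟩ : Fin d) = i₀
      · have e : (fun z => padZero D (perturb i₀ a (m : ℝ)⁻¹
            (gridCentre : (Fin d → Fin m) → _) ε z) k) =
            (fun z : EuclideanSpace ℝ (Fin d) => z ⟨k, hk⟩) +
              bumpSum a (m : ℝ)⁻¹ (gridCentre : (Fin d → Fin m) → _) ε := by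
          ext z
          simp [padZero, perturb, hk, hki]
        simp only [e]
        exact ((hb _).add (hsum ε)).mem_holderBall (by linarith) (by linarith [hb0 ⟨k, hk⟩])
      · have e : (fun z => padZero D (perturb i₀ a (m : ℝ)⁻¹
            (gridCentre : (Fin d → Fin m) → _) ε z) k) =
            (fun z : EuclideanSpace ℝ (Fin d) => z ⟨k, hk⟩) := by
          ext z
          simp [padZero, perturb, hk, hki]
        simp only [e]
        exact (hb _).mem_holderBall (by linarith) (hb0 _)
    -- The zero function is treated as the bump sum with every bit off.
    · have e : (fun z => padZero D (perturb i₀ a (m : ℝ)⁻¹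
          (gridCentre : (Fin d → Fin m) → _) ε z) k) =
          bumpSum a (m : ℝ)⁻¹ (gridCentre : (Fin d → Fin m) → _) fun _ => false := by
        ext z
        simp [padZero, hk, bumpSum]
      simp only [e]
      exact (hsum _).mem_holderBall (by linarith) (by linarith)
  refine le_of_eq_of_le ?_ (le_wassersteinMinimaxRisk_of_cells hdD hh
    (fun i j hij => le_dist_gridCentre hij) ball_gridCentre_subset ha (haa₀.trans ha₀1)
    (hB 1 (by omega)) ((mul_le_mul_of_nonneg_right haa₀ (zero_le_one.trans hB1)).trans ha₀B)
    ?_ σ hmem)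
  -- The number `m ^ d` of cells cancels the cell volume `h ^ d`.
  · congr 1
    rw [Fintype.card_fun, Fintype.card_fin, Fintype.card_fin]
    rw [inv_pow]
    push_cast
    field_simp
  · have e : (n : ℝ) * (a ^ 2 * ((m : ℝ)⁻¹ ^ d * V)) = n * a ^ 2 / (m : ℝ) ^ d * V := by
      rw [inv_pow]; field_simp
    rw [e]
    refine le_trans ?_ ha₀V
    gcongr
    rwa [div_le_iff₀ (by positivity)]

end

theorem theorem4 (d : ℕ) (hd : 1 ≤ d) (β : ℝ) (hβ : 0 < β)
    (hpos : 0 < 2 * β + d - 2) (hreg : d ≤ 2 ∨ 1 ≤ β) :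
    ∃ K₀ : ℝ, ∃ C : ℝ, 0 < C ∧
      ∀ K : ℝ, K₀ ≤ K → ∀ D : ℕ, d ≤ D → ∀ σ₀ : ℝ, 0 ≤ σ₀ → ∀ n : ℕ, 1 ≤ n →
        ENNReal.ofReal (C * (n : ℝ) ^ (-(β / (2 * β + d - 2)))) ≤
          wassersteinMinimaxRisk (generatorClass d D β K) σ₀ n := by
  obtain ⟨K₀, a₀, κ, ha₀, hκ, H⟩ := exists_le_wassersteinMinimaxRisk d hd hβ
  refine ⟨K₀, κ * (a₀ * 2 ^ (-β)), by positivity, fun K hK D hD σ₀ _ n hn => ?_⟩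
  have hn1 : (1 : ℝ) ≤ n := by exact_mod_cast hn
  have hn0 : (0 : ℝ) < n := by linarith
  rcases hreg with hd2 | hβ1
  -- For `d ≤ 2` the target exponent `β / (2β + d - 2)` is at least `1 / 2`, so the parametric rate
  -- from a single cell is enough.
  · refine le_trans (ENNReal.ofReal_le_ofReal ?_) (H K hK D hD σ₀ n 1 le_rfl
      (a₀ * (n : ℝ) ^ (-(1 / 2) : ℝ)) (by positivity) ?_ ?_ ?_)
    · rw [Nat.cast_one, inv_one, mul_one, mul_assoc, mul_assoc]
      gcongr
      have h2 : (2 : ℝ) ^ (-β) ≤ 1 := Real.rpow_le_one_of_one_le_of_nonpos one_le_two (by linarith)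
      have h3 : (n : ℝ) ^ (-(β / (2 * β + d - 2))) ≤ (n : ℝ) ^ (-(1 / 2) : ℝ) := by
        refine Real.rpow_le_rpow_of_exponent_le hn1 (neg_le_neg ?_)
        rw [div_le_div_iff₀ two_pos hpos]
        have : (d : ℝ) ≤ 2 := by exact_mod_cast hd2
        linarith
      calc (2 : ℝ) ^ (-β) * (n : ℝ) ^ (-(β / (2 * β + d - 2)))
          ≤ 1 * (n : ℝ) ^ (-(1 / 2) : ℝ) := by gcongr
        _ = _ := one_mul _
    · exact mul_le_of_le_one_right ha₀.le
        (Real.rpow_le_one_of_one_le_of_nonpos hn1 (by norm_num))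
    · rw [Nat.cast_one, Real.one_rpow, mul_one]
      exact mul_le_of_le_one_right ha₀.le
        (Real.rpow_le_one_of_one_le_of_nonpos hn1 (by norm_num))
    · rw [mul_pow, ← Real.rpow_natCast ((n : ℝ) ^ _), ← Real.rpow_mul hn0.le]
      norm_num
      rw [Real.rpow_neg_one]
      field_simp
      exact le_rfl
  -- The height `a₀ * m ^ (1 - β)` saturates the Hölder constraint; `β ≥ 1` keeps it below `a₀`.
  -- Rounding `n ^ (1 / p)` up at most doubles it, which costs the factor `2 ^ (-β)` in the
  -- constant.
  · set p := 2 * β + d - 2 with hp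
    set x := (n : ℝ) ^ (1 / p) with hx
    have hx1 : 1 ≤ x := Real.one_le_rpow hn1 (by positivity)
    set m := ⌈x⌉₊ with hm
    have hxm : x ≤ m := Nat.le_ceil x
    have hmx : (m : ℝ) ≤ 2 * x := by
      have := Nat.ceil_lt_add_one (zero_le_one.trans hx1)
      linarith
    have hm1 : (1 : ℝ) ≤ m := hx1.trans hxm
    have hm0 : (0 : ℝ) < m := by linarith
    refine le_trans (ENNReal.ofReal_le_ofReal ?_) (H K hK D hD σ₀ n m (by exact_mod_cast hm1)
      (a₀ * (m : ℝ) ^ (1 - β)) (by positivity) ?_ ?_ ?_)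
    · have e : (m : ℝ) ^ (1 - β) * (m : ℝ)⁻¹ = (m : ℝ) ^ (-β) := by
        rw [← Real.rpow_neg_one, ← Real.rpow_add hm0]; congr 1; ring
      have e2 : (2 : ℝ) ^ (-β) * (n : ℝ) ^ (-(β / p)) = (2 * x) ^ (-β) := by
        rw [Real.mul_rpow two_pos.le (by positivity), hx, ← Real.rpow_mul hn0.le]
        congr 2; ring
      rw [mul_assoc, mul_assoc, mul_assoc, e, e2]
      gcongr κ * (a₀ * ?_)
      exact Real.rpow_le_rpow_of_nonpos hm0 hmx (by linarith)
    · exact mul_le_of_le_one_right ha₀.le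
        (Real.rpow_le_one_of_one_le_of_nonpos hm1 (by linarith))
    · rw [mul_assoc, ← Real.rpow_add hm0]
      simp
    -- Since `d = p + 2 (1 - β)`, the sample size constraint reduces to `n ≤ m ^ p`.
    · have e : (m : ℝ) ^ d = (m : ℝ) ^ p * ((m : ℝ) ^ (1 - β)) ^ 2 := by
        rw [← Real.rpow_natCast, ← Real.rpow_natCast, ← Real.rpow_mul hm0.le,
          ← Real.rpow_add hm0]
        congr 1; push_cast; rw [hp]; ring
      have hnp : (n : ℝ) ≤ (m : ℝ) ^ p := by
        calc (n : ℝ) = x ^ p := by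
              rw [hx, ← Real.rpow_mul hn0.le, one_div_mul_cancel hpos.ne', Real.rpow_one]
          _ ≤ (m : ℝ) ^ p := Real.rpow_le_rpow (by positivity) hxm hpos.le
      rw [e, mul_pow]
      calc (n : ℝ) * (a₀ ^ 2 * ((m : ℝ) ^ (1 - β)) ^ 2)
          ≤ (m : ℝ) ^ p * (a₀ ^ 2 * ((m : ℝ) ^ (1 - β)) ^ 2) := by gcongr
        _ = _ := by ring
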